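/- Let $\mathcal X$ be a set, $n\ge 1$ and $x_1,\dots,x_n\in\mathcal X$ deterministic points, not necessarily distinct. Let $Y_1,\dots,Y_n$ be independent integrable real random variables with $\mathbb E[Y_i]=f^\star(x_i)$ for some function $f^\star:\mathcal X\to\mathbb R$. Set $$\ell(f,g)=\frac1n\sum_{i=1}^n|f(x_i)-g(x_i)|,\qquad \ell(f,\mathcal G)=\inf_{g\in\mathcal G}\ell(f,g),\qquad \sigma_p=\Big(\frac1n\sum_{i=1}^n\mathbb E\big[|Y_i-\mathbb E[Y_i]|^p\big]\Big)^{1/p}\in[0,+\infty].$$ For a class $\mathcal F$ of real functions on $\mathcal X$, $f,g\in\mathcal F$ and $\mathfrak c\ge 0$, set $$T(f,g)=\sum_{i=1}^n\big(f(x_i)-Y_i\big)\,\mathrm{sgn}\big(f(x_i)-g(x_i)\big),\qquad T(f)=\sup_{g\in\mathcal F}T(f,g),$$ with $\mathrm{sgn}(0)=0$, and let $\widehat f$ be any random element of $\{f\in\mathcal F:\ T(f)\le \inf_{g\in\mathcal F}T(g)+\mathfrak c\}$ for which $\ell(f^\star,\widehat f)$ is measurable. A class $\mathcal A$ of subsets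 of a set $\mathcal Y$ has VC-dimension not larger than $D$ if $|\{B\cap A: A\in\mathcal A\}|<2^{|B|}$ for every finite $B\subset\mathcal Y$ with $|B|>D$. An element $\overline g$ of a class $\mathcal G$ of real functions on $\mathcal Y$ is extremal in $\mathcal G$ with degree not larger than $D\ge1$ if the classes $\{\{g>\overline g\}: g\in\mathcal G\}$ and $\{\{g<\overline g\}: g\in\mathcal G\}$ both have VC-dimension not larger than $D$. Let $\mathcal O(D)$ be the set of those $f\in\mathcal F$ whose restriction to $\{x_1,\dots,x_n\}$ is extremal with degree not larger than $D$ in the class of the restrictions of the elements of $\mathcal F$ to this set. (i) If $\mathcal F$ is a linear space of real functions on $\mathcal X$ with finite dimension $d\ge1$, then every element of $\mathcal F$ is extremal in $\mathcal F$ with degree not larger than $d+1$, and $\mathcal O(d+1)=\mathcal F$. (ii) There is a numerical constant $\kappa>0$ such that, in the above setting, whenever $\mathcal F$ is a linear space of real functions on $\mathcal X$ with finite dimension $d\ge1$, the random variable $\ell(f^\star,\widehat f)$ is integrable and $$\mathbb E\big[\ell(f^\star,\widehat f)\big]\le 3\,\ell(f^\star,\mathcal F)+\kappa\inf_{p\in[1,2]}\Big\{\sigma_p\Big(\frac{(d+1)\wedge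 n}{n}\Big)^{1-1/p}\Big\}+\frac{\mathfrak c}{n}.$$ -/

import Mathlib

open MeasureTheory ProbabilityTheory
open scoped ENNReal

namespace L1Regression

noncomputable section

/-! ### VC-dimension and extremal elements of a class of functions -/

/-- The VC-dimension of the class `𝒜` of subsets of `𝒴` is not larger than `D`: for every finite
set `B` with more than `D` elements, the number of traces `B ∩ A`, `A ∈ 𝒜`, is smaller
than `2 ^ |B|`. -/
def VCDimLE {𝒴 : Type*} (𝒜 : Set (Set 𝒴)) (D : ℕ) : Prop :=
  ∀ B : Finset 𝒴, D < B.card → ((fun A : Set 𝒴 => (B : Set 𝒴) ∩ A) '' 𝒜).ncard < 2 ^ B.card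

/-- The class of sets `{g > g₀}`, for `g ∈ 𝒢`. -/
def upperSets {𝒴 : Type*} (𝒢 : Set (𝒴 → ℝ)) (g₀ : 𝒴 → ℝ) : Set (Set 𝒴) :=
  (fun g : 𝒴 → ℝ => {y | g₀ y < g y}) '' 𝒢

/-- The class of sets `{g < g₀}`, for `g ∈ 𝒢`. -/
def lowerSets {𝒴 : Type*} (𝒢 : Set (𝒴 → ℝ)) (g₀ : 𝒴 → ℝ) : Set (Set 𝒴) :=
  (fun g : 𝒴 → ℝ => {y | g y < g₀ y}) '' 𝒢

/-- `g₀` is an element of `𝒢` which is extremal in `𝒢` with degree not larger than `D ≥ 1`. -/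
def IsExtremal {𝒴 : Type*} (𝒢 : Set (𝒴 → ℝ)) (g₀ : 𝒴 → ℝ) (D : ℕ) : Prop :=
  1 ≤ D ∧ g₀ ∈ 𝒢 ∧ VCDimLE (upperSets 𝒢 g₀) D ∧ VCDimLE (lowerSets 𝒢 g₀) D

/-- The restriction of a function on `𝒳` to the set of design points `{x₁, …, xₙ}`. -/
def restrictDesign {𝒳 : Type*} {n : ℕ} (x : Fin n → 𝒳) (f : 𝒳 → ℝ) : Set.range x → ℝ :=
  fun z => f z

/-- The set `𝒪(D)` of those elements of `ℱ` whose restrictions to the design points are extremal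
with degree not larger than `D` in the class of the restrictions of the elements of `ℱ`. -/
def extremalSet {𝒳 : Type*} {n : ℕ} (x : Fin n → 𝒳) (ℱ : Set (𝒳 → ℝ)) (D : ℕ) :
    Set (𝒳 → ℝ) :=
  {f | f ∈ ℱ ∧ IsExtremal (restrictDesign x '' ℱ) (restrictDesign x f) D}

/-! ### The loss and the estimator -/

/-- The loss `ℓ(f, g) = n⁻¹ ∑ᵢ |f(xᵢ) - g(xᵢ)|`. -/
def loss {𝒳 : Type*} {n : ℕ} (x : Fin n → 𝒳) (f g : 𝒳 → ℝ) : ℝ :=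
  (1 / (n : ℝ)) * ∑ i, |f (x i) - g (x i)|

/-- The approximation error `ℓ(f, 𝒢) = inf_{g ∈ 𝒢} ℓ(f, g)`, which is `+∞` if `𝒢` is empty. -/
def lossToSet {𝒳 : Type*} {n : ℕ} (x : Fin n → 𝒳) (f : 𝒳 → ℝ) (𝒢 : Set (𝒳 → ℝ)) : ℝ≥0∞ :=
  ⨅ g ∈ 𝒢, ENNReal.ofReal (loss x f g)

/-- The test statistic `T(Z, f, g) = ∑ᵢ (f(xᵢ) - yᵢ) sgn(f(xᵢ) - g(xᵢ))` at the data
`Z = ((x₁, y₁), …, (xₙ, yₙ))`. -/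
def testStat {𝒳 : Type*} {n : ℕ} (x : Fin n → 𝒳) (y : Fin n → ℝ) (f g : 𝒳 → ℝ) : ℝ :=
  ∑ i, (f (x i) - y i) * Real.sign (f (x i) - g (x i))

/-- The criterion `T(Z, f) = sup_{g ∈ ℱ} T(Z, f, g)`. The set is bounded above, see
`bddAbove_testStat`. -/
def supStat {𝒳 : Type*} {n : ℕ} (x : Fin n → 𝒳) (y : Fin n → ℝ) (ℱ : Set (𝒳 → ℝ))
    (f : 𝒳 → ℝ) : ℝ :=
  sSup (testStat x y f '' ℱ)

/-- The set `{f ∈ ℱ, T(Z, f) ≤ inf_{g ∈ ℱ} T(Z, g) + c}`, of which the estimator is an element.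
The values over which the infimum is taken are nonnegative, see `supStat_nonneg`. -/
def estimatorSet {𝒳 : Type*} {n : ℕ} (x : Fin n → 𝒳) (y : Fin n → ℝ) (ℱ : Set (𝒳 → ℝ))
    (c : ℝ) : Set (𝒳 → ℝ) :=
  {f | f ∈ ℱ ∧ supStat x y ℱ f ≤ sInf (supStat x y ℱ '' ℱ) + c}

theorem bddAbove_testStat {𝒳 : Type*} {n : ℕ} (x : Fin n → 𝒳) (y : Fin n → ℝ)
    (ℱ : Set (𝒳 → ℝ)) (f : 𝒳 → ℝ) : BddAbove (testStat x y f '' ℱ) := by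
  refine ⟨∑ i, |f (x i) - y i|, ?_⟩
  rintro _ ⟨g, -, rfl⟩
  refine Finset.sum_le_sum fun i _ => ?_
  rcases Real.sign_apply_eq (f (x i) - g (x i)) with h | h | h <;> rw [h]
  · linarith [neg_abs_le (f (x i) - y i)]
  · simp
  · linarith [le_abs_self (f (x i) - y i)]

theorem supStat_nonneg {𝒳 : Type*} {n : ℕ} (x : Fin n → 𝒳) (y : Fin n → ℝ)
    (ℱ : Set (𝒳 → ℝ)) {f : 𝒳 → ℝ} (hf : f ∈ ℱ) : 0 ≤ supStat x y ℱ f := by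
  refine le_csSup_of_le (bddAbove_testStat x y ℱ f) ⟨f, hf, rfl⟩ ?_
  simp [testStat]

/-! ### The noise level -/

/-- `σ_p(x) = (n⁻¹ ∑ᵢ 𝔼[|Yᵢ - 𝔼[Yᵢ]|^p])^{1/p}`, with values in `[0, +∞]`. -/
def noiseLevel {Ω : Type*} [MeasurableSpace Ω] (μ : Measure Ω) {n : ℕ} (Y : Fin n → Ω → ℝ)
    (p : ℝ) : ℝ≥0∞ :=
  ((n : ℝ≥0∞)⁻¹ * ∑ i, ∫⁻ ω, ENNReal.ofReal (|Y i ω - ∫ ω', Y i ω' ∂μ| ^ p) ∂μ) ^ (1 / p)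

end

end L1Regression

/-! For `f`, `g` in a linear space, `{g > f}` and `{g < f}` are the positivity sets of `g - f` and
`f - g`, so everything rests on the sets `{h > 0}`, `h ∈ ℱ`. On more than `d` points the values of
`ℱ` form a proper subspace, killed by a nonzero functional; the sign pattern of its coefficients is
then missed by every `h` (`exists_set_forall_pos_ne`). The VC-dimension is thus at most `d`, which
gives (i).

For (ii), put `ξᵢ = Yᵢ - f⋆(xᵢ)` and let `Z` be the maximum of `|∑_{i ∈ A} ξᵢ|` over the traces `A`
of these sets. Then `T(f, g) ≤ n ℓ(f⋆, f) + 2Z`, while `T(f, g) + T(g, f) = n ℓ(f, g)` no longer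
contains the data. Comparing `f̂` with any `f ∈ ℱ` gives `ℓ(f⋆, f̂) ≤ 3 ℓ(f⋆, f) + 4Z/n + 𝔠/n`
pointwise (`loss_le_of_mem_estimatorSet`).

It remains to bound `𝔼 Z`. Symmetrization reduces it to Rademacher sums over a VC class. Coordinates
larger than a threshold `t` are bounded trivially; the others by chaining, with Dudley's packing
bound (`log_card_le_of_separated`). This yields `54 D t + 3 t^(1-p) ∑ 𝔼|ξᵢ|^p` for every `t > 0` and
`p ∈ [1, 2]`, and optimizing `t` gives the rate. Suprema over sets are handled through selectors,
that is, arbitrary choices of a set depending on the signs. -/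

namespace L1Regression

open scoped BigOperators

/-! ### Sign patterns of linear spaces and extremality -/

/-- A linear space of dimension smaller than `|β|` misses a sign pattern on `β`. -/
theorem exists_set_forall_pos_ne {V β : Type*} [AddCommGroup V] [Module ℝ V]
    [FiniteDimensional ℝ V] [Fintype β] (Φ : V →ₗ[ℝ] (β → ℝ))
    (h : Module.finrank ℝ V < Fintype.card β) :
    ∃ s : Set β, ∀ v, {b | 0 < Φ v b} ≠ s := by
  classical
  have hlt : LinearMap.range Φ < ⊤ := by
    refine lt_top_iff_ne_top.2 fun htop => ?_
    have h1 := LinearMap.finrank_range_le Φ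
    rw [htop, finrank_top, Module.finrank_fintype_fun_eq_card] at h1
    omega
  obtain ⟨f, hf0, hf⟩ := Submodule.exists_le_ker_of_lt_top _ hlt
  have key : ∀ g : (β → ℝ) →ₗ[ℝ] ℝ, LinearMap.range Φ ≤ LinearMap.ker g →
      (∃ b, 0 < g (Pi.single b 1)) → ∃ s : Set β, ∀ v, {b | 0 < Φ v b} ≠ s := by
    rintro g hg ⟨b₀, hb₀⟩
    -- If `Φ v` were positive exactly where the coefficients of `g` are, every term of `g (Φ v)`
    -- would be nonnegative and the one at `b₀` positive, although `g` kills the range.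
    refine ⟨{b | 0 < g (Pi.single b 1)}, fun v hv => ?_⟩
    have h0 : g (Φ v) = 0 := hg ⟨v, rfl⟩
    have hsum : g (Φ v) = ∑ b, Φ v b * g (Pi.single b 1) := by
      rw [LinearMap.pi_apply_eq_sum_univ g (Φ v)]
      refine Finset.sum_congr rfl fun b _ => ?_
      rw [smul_eq_mul]
      congr 2
      ext j
      simp [Pi.single_apply, eq_comm]
    have hmem : ∀ b, 0 < Φ v b ↔ 0 < g (Pi.single b 1) := fun b => by
      have := Set.ext_iff.1 hv b
      simpa using this
    have hpos : 0 < ∑ b, Φ v b * g (Pi.single b 1) := by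
      refine Finset.sum_pos' (fun b _ => ?_)
        ⟨b₀, Finset.mem_univ _, mul_pos ((hmem b₀).2 hb₀) hb₀⟩
      by_cases hb : 0 < Φ v b
      · exact (mul_pos hb ((hmem b).1 hb)).le
      · exact mul_nonneg_of_nonpos_of_nonpos (not_lt.1 hb)
          (not_lt.1 fun h => hb ((hmem b).2 h))
    linarith
  -- A nonzero functional has a nonzero coefficient, so `f` or `-f` has a positive one.
  by_cases hex : ∃ b, 0 < f (Pi.single b 1)
  · exact key f hf hex
  · push Not at hex
    refine key (-f) (fun y hy => by simpa using hf hy) ?_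
    by_contra hne
    push Not at hne
    refine hf0 (LinearMap.pi_ext' fun b => LinearMap.ext_ring ?_)
    have h1 := hex b
    have h2 := hne b
    simp only [LinearMap.neg_apply] at h2
    simp only [LinearMap.comp_apply, LinearMap.single_apply, LinearMap.zero_apply]
    linarith

theorem vcDimLE_of_forall_pos {𝒴 : Type*} (𝒢 : Submodule ℝ (𝒴 → ℝ)) [FiniteDimensional ℝ 𝒢]
    {D : ℕ} (hD : Module.finrank ℝ 𝒢 ≤ D) {𝒜 : Set (Set 𝒴)}
    (h𝒜 : ∀ A ∈ 𝒜, ∃ h ∈ 𝒢, A = {y | 0 < h y}) : VCDimLE 𝒜 D := by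
  intro B hB
  obtain ⟨s, hs⟩ := exists_set_forall_pos_ne
    ((LinearMap.funLeft ℝ ℝ (Subtype.val : B → 𝒴)).comp 𝒢.subtype)
    (by rw [Fintype.card_coe]; omega)
  -- The traces lie in the powerset of `B`, strictly because `s` is missed.
  rw [← Set.ncard_coe_finset, ← Set.ncard_powerset (B : Set 𝒴) B.finite_toSet]
  refine Set.ncard_lt_ncard ⟨?_, fun hsub => ?_⟩ B.finite_toSet.powerset
  · rintro _ ⟨A, -, rfl⟩
    exact Set.inter_subset_left
  · obtain ⟨A, hA, hAs⟩ := hsub (show Subtype.val '' s ∈ 𝒫 (B : Set 𝒴) by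
      rintro _ ⟨b, -, rfl⟩
      exact b.2)
    obtain ⟨h, hh, rfl⟩ := h𝒜 A hA
    refine hs ⟨h, hh⟩ ?_
    ext b
    have := Set.ext_iff.1 hAs b
    simpa [LinearMap.funLeft_apply] using this

theorem isExtremal_of_finrank_le {𝒴 : Type*} (𝒢 : Submodule ℝ (𝒴 → ℝ)) [FiniteDimensional ℝ 𝒢]
    {D : ℕ} (hD1 : 1 ≤ D) (hD : Module.finrank ℝ 𝒢 ≤ D) {f : 𝒴 → ℝ} (hf : f ∈ 𝒢) :
    IsExtremal (𝒢 : Set (𝒴 → ℝ)) f D := by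
  refine ⟨hD1, hf, vcDimLE_of_forall_pos 𝒢 hD ?_, vcDimLE_of_forall_pos 𝒢 hD ?_⟩
  · rintro _ ⟨g, hg, rfl⟩
    exact ⟨g - f, 𝒢.sub_mem hg hf, by simp⟩
  · rintro _ ⟨g, hg, rfl⟩
    exact ⟨f - g, 𝒢.sub_mem hf hg, by simp⟩

theorem extremalSet_eq_of_finrank_le {𝒳 : Type*} (ℱ : Submodule ℝ (𝒳 → ℝ))
    [FiniteDimensional ℝ ℱ] {D : ℕ} (hD1 : 1 ≤ D) (hD : Module.finrank ℝ ℱ ≤ D) {n : ℕ}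
    (x : Fin n → 𝒳) : extremalSet x (ℱ : Set (𝒳 → ℝ)) D = (ℱ : Set (𝒳 → ℝ)) := by
  refine Set.Subset.antisymm (fun f hf => hf.1) fun f hf => ⟨hf, ?_⟩
  have himage : restrictDesign x '' (ℱ : Set (𝒳 → ℝ)) =
      (ℱ.map (LinearMap.funLeft ℝ ℝ (Subtype.val : Set.range x → 𝒳)) :
        Set (Set.range x → ℝ)) := rfl
  rw [himage]
  exact isExtremal_of_finrank_le _ hD1 ((Submodule.finrank_map_le _ _).trans hD)
    (Submodule.mem_map_of_mem hf)

/-! ### Packing numbers of VC classes -/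

/-- The Sauer bound on sums of binomial coefficients. -/
theorem sum_choose_le_pow {m D : ℕ} (hD : 1 ≤ D) (hm : D ≤ m) :
    ((∑ k ∈ Finset.Iic D, m.choose k : ℕ) : ℝ) ≤ (Real.exp 1 * m / D) ^ D := by
  have hD0 : (0 : ℝ) < D := by exact_mod_cast hD
  have hm0 : (0 : ℝ) < m := by exact_mod_cast hD.trans hm
  -- Since `r ≤ 1`, `r ^ D ≤ r ^ k` for `k ≤ D`, and the binomial theorem bounds the weighted sum by
  -- `(1 + r) ^ m ≤ exp (r m) = exp D`.
  set r : ℝ := D / m with hr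
  have hr0 : 0 < r := by positivity
  have hr1 : r ≤ 1 := (div_le_one hm0).2 (by exact_mod_cast hm)
  have h1 : r ^ D * ((∑ k ∈ Finset.Iic D, m.choose k : ℕ) : ℝ) ≤ Real.exp D := by
    calc r ^ D * ((∑ k ∈ Finset.Iic D, m.choose k : ℕ) : ℝ)
        = ∑ k ∈ Finset.Iic D, r ^ D * (m.choose k : ℝ) := by
          push_cast
          rw [Finset.mul_sum]
      _ ≤ ∑ k ∈ Finset.Iic D, r ^ k * (m.choose k : ℝ) := by
          refine Finset.sum_le_sum fun k hk => ?_
          exact mul_le_mul_of_nonneg_right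
            (pow_le_pow_of_le_one hr0.le hr1 (Finset.mem_Iic.1 hk)) (Nat.cast_nonneg _)
      _ ≤ ∑ k ∈ Finset.range (m + 1), r ^ k * (m.choose k : ℝ) := by
          refine Finset.sum_le_sum_of_subset_of_nonneg (fun k hk => ?_)
            fun k _ _ => by positivity
          have := Finset.mem_Iic.1 hk
          exact Finset.mem_range.2 (by omega)
      _ = (r + 1) ^ m := by
          rw [add_pow]
          simp
      _ ≤ Real.exp r ^ m := pow_le_pow_left₀ (by positivity) (Real.add_one_le_exp r) m
      _ = Real.exp D := by
          rw [← Real.exp_nat_mul, hr, mul_div_cancel₀ _ hm0.ne']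
  have h2 : (Real.exp 1 * m / D) ^ D = Real.exp D / r ^ D := by
    rw [hr, ← mul_one (D : ℝ), Real.exp_nat_mul, mul_one, ← div_pow]
    congr 1
    field_simp
  rw [h2, le_div_iff₀ (by positivity), mul_comm]
  exact h1

theorem card_le_pow_of_shatters {m D : ℕ} (hD : 1 ≤ D) (hm : D ≤ m)
    (𝒯 : Finset (Finset (Fin m))) (h𝒯 : ∀ J, 𝒯.Shatters J → J.card ≤ D) :
    (𝒯.card : ℝ) ≤ (Real.exp 1 * m / D) ^ D := by
  refine le_trans ?_ (sum_choose_le_pow hD hm)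
  have hdim : 𝒯.vcDim ≤ D := Finset.sup_le fun J hJ => h𝒯 J (Finset.mem_shatterer.1 hJ)
  have h1 := 𝒯.card_le_card_shatterer.trans Finset.card_shatterer_le_sum_vcDim
  rw [Fintype.card_fin] at h1
  exact_mod_cast h1.trans (Finset.sum_le_sum_of_subset (Finset.Iic_subset_Iic.2 hdim))

/-- Independent sampling separates the elements of a separated class. -/
theorem exists_sample_separating {ι : Type*} [Fintype ι] [DecidableEq ι] (w : ι → ℝ)
    (hw : ∀ i, 0 ≤ w i) (hw1 : ∑ i, w i = 1) {ε : ℝ} (𝒩 : Finset (Finset ι))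
    (hsep : ∀ A ∈ 𝒩, ∀ B ∈ 𝒩, A ≠ B → ε ≤ ∑ i ∈ symmDiff A B, w i) {m : ℕ}
    (hm : (𝒩.offDiag.card : ℝ) * (1 - ε) ^ m < 1) :
    ∃ s : Fin m → ι, ∀ A ∈ 𝒩, ∀ B ∈ 𝒩, A ≠ B → ∃ j, s j ∈ symmDiff A B := by
  -- Probabilistic method: for `m` independent draws from `w`, a given pair is not separated with
  -- probability at most `(1 - ε) ^ m`, and `hm` makes the union bound smaller than one.
  by_contra hne
  push Not at hne
  refine absurd hm (not_lt.2 ?_)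
  have hone : ∀ s : Fin m → ι, ∏ j, w (s j) ≤
      ∑ P ∈ 𝒩.offDiag, ∏ j, if s j ∈ symmDiff P.1 P.2 then 0 else w (s j) := by
    intro s
    obtain ⟨A, hA, B, hB, hAB, h⟩ := hne s
    refine le_trans (le_of_eq ?_) (Finset.single_le_sum (f := fun P : Finset ι × Finset ι =>
      ∏ j, if s j ∈ symmDiff P.1 P.2 then 0 else w (s j)) (fun P _ =>
        Finset.prod_nonneg fun j _ => by split_ifs <;> simp [hw])
        (Finset.mem_offDiag.2 ⟨hA, hB, hAB⟩ : (A, B) ∈ 𝒩.offDiag))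
    exact Finset.prod_congr rfl fun j _ => by simp only [if_neg (h j)]
  calc (1 : ℝ) = (∑ i, w i) ^ m := by rw [hw1, one_pow]
    _ = ∑ s : Fin m → ι, ∏ j, w (s j) := Fintype.sum_pow w m
    _ ≤ ∑ s : Fin m → ι, ∑ P ∈ 𝒩.offDiag,
          ∏ j, if s j ∈ symmDiff P.1 P.2 then 0 else w (s j) :=
        Finset.sum_le_sum fun s _ => hone s
    _ = ∑ P ∈ 𝒩.offDiag, (∑ i, if i ∈ symmDiff P.1 P.2 then 0 else w i) ^ m := by
        rw [Finset.sum_comm]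
        refine Finset.sum_congr rfl fun P _ => ?_
        rw [Fintype.sum_pow]
    _ ≤ ∑ P ∈ 𝒩.offDiag, (1 - ε) ^ m := by
        refine Finset.sum_le_sum fun P hP => ?_
        obtain ⟨h1, h2, h3⟩ := Finset.mem_offDiag.1 hP
        refine pow_le_pow_left₀ (Finset.sum_nonneg fun i _ => by split_ifs <;> simp [hw]) ?_ m
        have h4 := hsep _ h1 _ h2 h3
        have h5 : (∑ i, if i ∈ symmDiff P.1 P.2 then 0 else w i) +
            ∑ i ∈ symmDiff P.1 P.2, w i = 1 := by
          rw [← hw1, ← Finset.sum_filter_add_sum_filter_not Finset.univ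
            (fun i => i ∈ symmDiff P.1 P.2) w, add_comm, Finset.filter_univ_mem, Finset.sum_filter]
          simp only [ite_not]
        linarith
    _ = (𝒩.offDiag.card : ℝ) * (1 - ε) ^ m := by rw [Finset.sum_const, nsmul_eq_mul]

/-- Dudley's bound on the packing numbers of a VC class. -/
theorem log_card_le_of_separated {ι : Type*} [Fintype ι] [DecidableEq ι] (w : ι → ℝ)
    (hw : ∀ i, 0 ≤ w i) (hw1 : ∑ i, w i = 1) {ε : ℝ} (hε : 0 < ε) (hε1 : ε ≤ 1)
    (𝒩 : Finset (Finset ι)) (hsep : ∀ A ∈ 𝒩, ∀ B ∈ 𝒩, A ≠ B → ε ≤ ∑ i ∈ symmDiff A B, w i)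
    {D : ℕ} (hD : 1 ≤ D) (hvc : ∀ B, 𝒩.Shatters B → B.card ≤ D) :
    Real.log 𝒩.card ≤ D * (4 + 2 * Real.log (1 / ε)) := by
  have hD0 : (1 : ℝ) ≤ D := by exact_mod_cast hD
  have hlε : 0 ≤ Real.log (1 / ε) := Real.log_nonneg (by rw [le_div_iff₀ hε]; linarith)
  rcases Nat.eq_zero_or_pos 𝒩.card with h0 | hpos
  · rw [h0]
    simp only [Nat.cast_zero, Real.log_zero]
    positivity
  have hN : (1 : ℝ) ≤ 𝒩.card := by exact_mod_cast hpos
  have hlN : 0 ≤ Real.log 𝒩.card := Real.log_nonneg hN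
  -- The first term makes `exp (-ε m)` at most `|𝒩|⁻²`, which beats the number of pairs; adding `D`
  -- gives `D ≤ m`, as the Sauer bound requires.
  set m : ℕ := ⌈2 * Real.log 𝒩.card / ε⌉₊ + D with hmdef
  have hmD : D ≤ m := by omega
  have hm_lower : 2 * Real.log 𝒩.card ≤ ε * m := by
    have h1 := Nat.le_ceil (2 * Real.log 𝒩.card / ε)
    rw [div_le_iff₀ hε] at h1
    have h2 : (⌈2 * Real.log 𝒩.card / ε⌉₊ : ℝ) ≤ m := by
      rw [hmdef]
      push_cast
      linarith
    nlinarith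
  have hm_upper : (m : ℝ) ≤ 2 * Real.log 𝒩.card / ε + 1 + D := by
    have h1 := (Nat.ceil_lt_add_one (a := 2 * Real.log 𝒩.card / ε) (by positivity)).le
    rw [hmdef]
    push_cast
    linarith
  have hm : (𝒩.offDiag.card : ℝ) * (1 - ε) ^ m < 1 := by
    have h1 : (1 - ε) ^ m ≤ Real.exp (-(2 * Real.log 𝒩.card)) := by
      calc (1 - ε) ^ m ≤ Real.exp (-ε) ^ m :=
            pow_le_pow_left₀ (by linarith) (Real.one_sub_le_exp_neg ε) m
        _ = Real.exp (-(ε * m)) := by rw [← Real.exp_nat_mul]; ring_nf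
        _ ≤ _ := Real.exp_le_exp.2 (by linarith)
    have h2 : Real.exp (-(2 * Real.log 𝒩.card)) * ((𝒩.card : ℝ) * 𝒩.card) = 1 := by
      rw [Real.exp_neg, two_mul, Real.exp_add, Real.exp_log (by linarith)]
      exact inv_mul_cancel₀ (by positivity)
    have h3 : (𝒩.offDiag.card : ℝ) < (𝒩.card : ℝ) * 𝒩.card := by
      rw [Finset.offDiag_card]
      have : 𝒩.card * 𝒩.card - 𝒩.card < 𝒩.card * 𝒩.card := by
        have := Nat.mul_pos hpos hpos
        omega
      exact_mod_cast this
    have h4 := Real.exp_pos (-(2 * Real.log 𝒩.card))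
    calc (𝒩.offDiag.card : ℝ) * (1 - ε) ^ m
        ≤ (𝒩.offDiag.card : ℝ) * Real.exp (-(2 * Real.log 𝒩.card)) :=
          mul_le_mul_of_nonneg_left h1 (Nat.cast_nonneg _)
      _ < (𝒩.card : ℝ) * 𝒩.card * Real.exp (-(2 * Real.log 𝒩.card)) :=
          mul_lt_mul_of_pos_right h3 h4
      _ = 1 := by rw [mul_comm, h2]
  obtain ⟨s, hs⟩ := exists_sample_separating w hw hw1 𝒩 hsep hm
  set tr : Finset ι → Finset (Fin m) := fun A => Finset.univ.filter fun j => s j ∈ A with htr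
  have hmem : ∀ A j, j ∈ tr A ↔ s j ∈ A := fun A j => by simp [htr]
  have hinj : Set.InjOn tr 𝒩 := by
    intro A hA B hB hAB
    by_contra hne
    obtain ⟨j, hj⟩ := hs A hA B hB hne
    have : s j ∈ A ↔ s j ∈ B := by rw [← hmem, hAB, hmem]
    rw [Finset.mem_symmDiff] at hj
    tauto
  have hshat : ∀ J, (𝒩.image tr).Shatters J → J.card ≤ D := by
    intro J hJ
    have hex : ∀ t ⊆ J, ∃ A ∈ 𝒩, ∀ j ∈ J, (s j ∈ A ↔ j ∈ t) := by
      intro t ht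
      obtain ⟨u, hu, hut⟩ := hJ ht
      obtain ⟨A, hA, rfl⟩ := Finset.mem_image.1 hu
      refine ⟨A, hA, fun j hj => ?_⟩
      rw [← hmem, ← hut, Finset.mem_inter]
      tauto
    -- Repeated sample points cannot be split by a trace, so a shattered `J` carries distinct points
    -- and its image is shattered by `𝒩`.
    have hsinj : Set.InjOn s J := by
      intro i hi j hj hij
      obtain ⟨A, -, hA⟩ := hex {i} (Finset.singleton_subset_iff.2 hi)
      have h1 := (hA i hi).2 (Finset.mem_singleton_self i)
      rw [hij] at h1
      exact (Finset.mem_singleton.1 ((hA j hj).1 h1)).symm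
    rw [← Finset.card_image_of_injOn hsinj]
    refine hvc _ fun t ht => ?_
    obtain ⟨A, hA, hAJ⟩ := hex (J.filter fun j => s j ∈ t) (Finset.filter_subset _ _)
    refine ⟨A, hA, ?_⟩
    ext i
    rw [Finset.mem_inter]
    constructor
    · rintro ⟨hi, hiA⟩
      obtain ⟨j, hj, rfl⟩ := Finset.mem_image.1 hi
      exact (Finset.mem_filter.1 ((hAJ j hj).1 hiA)).2
    · intro hi
      obtain ⟨j, hj, rfl⟩ := Finset.mem_image.1 (ht hi)
      exact ⟨ht hi, (hAJ j hj).2 (Finset.mem_filter.2 ⟨hj, hi⟩)⟩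
  have hcard := card_le_pow_of_shatters hD hmD (𝒩.image tr) hshat
  rw [Finset.card_image_of_injOn hinj] at hcard
  have hm0 : (0 : ℝ) < m := by exact_mod_cast hD.trans hmD
  set u : ℝ := Real.log 𝒩.card / D with hu
  have hu0 : 0 ≤ u := by positivity
  have hlog : Real.log 𝒩.card ≤ D * (1 + Real.log (m / D)) := by
    have := Real.log_le_log (by linarith) hcard
    rwa [Real.log_pow, mul_div_assoc, Real.log_mul (Real.exp_pos 1).ne' (by positivity),
      Real.log_exp] at this
  -- The Sauer bound reads `u ≤ 1 + log (m / D)`. Applying `log y ≤ y - 1` at `y = (1 + u) / 2`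
  -- leaves only `u / 2` on the right, to be absorbed on the left.
  have hmu : (m : ℝ) / D ≤ 4 * ((1 + u) / 2) * (1 / ε) := by
    rw [div_le_iff₀ (by linarith)]
    have h1 : 2 * Real.log 𝒩.card / ε = 2 * u * (1 / ε) * D := by
      rw [hu]
      field_simp
    have h2 : (1 : ℝ) ≤ 1 / ε := by rw [le_div_iff₀ hε]; linarith
    rw [h1] at hm_upper
    nlinarith [mul_le_mul h2 hD0 zero_le_one (by positivity)]
  have hlm : Real.log (m / D) ≤ Real.log 4 + ((1 + u) / 2 - 1) + Real.log (1 / ε) := by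
    refine (Real.log_le_log (by positivity) hmu).trans ?_
    rw [Real.log_mul (by positivity) (by positivity), Real.log_mul (by norm_num) (by positivity)]
    gcongr
    exact Real.log_le_sub_one_of_pos (by positivity)
  have hl4 : Real.log 4 ≤ 3 / 2 := by
    have : Real.log 4 = 2 * Real.log 2 := by
      rw [show (4 : ℝ) = 2 ^ 2 by norm_num, Real.log_pow]
      norm_num
    linarith [Real.log_two_lt_d9]
  have huD : Real.log 𝒩.card = D * u := by
    rw [hu]
    field_simp
  rw [huD] at hlog ⊢
  have h3 := le_of_mul_le_mul_left hlog (by linarith : (0 : ℝ) < D)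
  exact mul_le_mul_of_nonneg_left (by linarith) (by linarith)

/-- A finite class has a separated net. -/
theorem exists_separated_net {α : Type*} [DecidableEq α] (ρ : α → α → ℝ)
    (hρ : ∀ a b, ρ a b = ρ b a) (hρ0 : ∀ a, ρ a a = 0) {ε : ℝ} (hε : 0 < ε) (𝒜 : Finset α) :
    ∃ 𝒩 ⊆ 𝒜, (∀ a ∈ 𝒩, ∀ b ∈ 𝒩, a ≠ b → ε ≤ ρ a b) ∧ ∀ a ∈ 𝒜, ∃ b ∈ 𝒩, ρ a b ≤ ε := by
  induction 𝒜 using Finset.induction_on with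
  | empty => exact ⟨∅, le_rfl, by simp, by simp⟩
  | insert a 𝒜 ha ih =>
    obtain ⟨𝒩, hsub, hsep, hnet⟩ := ih
    by_cases h : ∃ b ∈ 𝒩, ρ a b ≤ ε
    · refine ⟨𝒩, hsub.trans (Finset.subset_insert _ _), hsep, fun a' ha' => ?_⟩
      rcases Finset.mem_insert.1 ha' with rfl | h'
      · exact h
      · exact hnet a' h'
    · push Not at h
      refine ⟨insert a 𝒩, Finset.insert_subset_insert _ hsub, ?_, fun a' ha' => ?_⟩
      · intro b hb c hc hbc
        rcases Finset.mem_insert.1 hb with rfl | hb' <;>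
          rcases Finset.mem_insert.1 hc with rfl | hc'
        · exact absurd rfl hbc
        · exact (h c hc').le
        · rw [hρ]
          exact (h b hb').le
        · exact hsep b hb' c hc' hbc
      · rcases Finset.mem_insert.1 ha' with rfl | h'
        · exact ⟨a', Finset.mem_insert_self _ _, by rw [hρ0]; exact hε.le⟩
        · obtain ⟨b, hb, hab⟩ := hnet a' h'
          exact ⟨b, Finset.mem_insert_of_mem hb, hab⟩

/-! ### Rademacher processes and chaining -/

/-- The sign `1` or `-1` given by a Boolean. -/
noncomputable def boolSign (b : Bool) : ℝ := if b then 1 else -1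

theorem abs_boolSign (b : Bool) : |boolSign b| = 1 := by cases b <;> simp [boolSign]

/-- Independence of the signs turns the average into `∏ cosh (b i)`, and `cosh x ≤ exp (x² / 2)`. -/
theorem expect_exp_sum_boolSign_le {ι : Type*} [Fintype ι] [DecidableEq ι] (b : ι → ℝ) :
    (𝔼 s : ι → Bool, Real.exp (∑ i, boolSign (s i) * b i)) ≤ Real.exp ((∑ i, b i ^ 2) / 2) := by
  have h1 : (∑ s : ι → Bool, Real.exp (∑ i, boolSign (s i) * b i)) =
      ∏ i, (2 * Real.cosh (b i)) := by
    have h2 : ∀ i, 2 * Real.cosh (b i) = ∑ x : Bool, Real.exp (boolSign x * b i) := fun i => by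
      rw [Real.cosh_eq]
      simp [boolSign]
      ring
    simp_rw [h2, Finset.prod_univ_sum, Fintype.piFinset_univ, Real.exp_sum]
  rw [Finset.expect_eq_sum_div_card, h1, Finset.prod_mul_distrib, Finset.prod_const,
    Finset.card_univ, Finset.card_univ, Fintype.card_fun, Fintype.card_bool]
  push_cast
  rw [mul_div_cancel_left₀ _ (by positivity), Finset.sum_div, Real.exp_sum]
  exact Finset.prod_le_prod (fun i _ => (Real.cosh_pos _).le)
    fun i _ => Real.cosh_le_exp_half_sq (b i)

/-- The maximal inequality for finitely many Rademacher sums. -/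
theorem expect_abs_selector_le {ι α : Type*} [Fintype ι] [DecidableEq ι] (𝒩 : Finset α)
    (b : α → ι → ℝ) {v : ℝ} (hv : ∀ j ∈ 𝒩, ∑ i, b j i ^ 2 ≤ v) (J : (ι → Bool) → α)
    (hJ : ∀ s, J s ∈ 𝒩) :
    (𝔼 s : ι → Bool, |∑ i, boolSign (s i) * b (J s) i|) ≤ Real.log (2 * 𝒩.card) + v / 2 := by
  have hN : (0 : ℝ) < 2 * 𝒩.card := by
    have : 0 < 𝒩.card := Finset.card_pos.2 ⟨_, hJ fun _ => true⟩
    positivity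
  set L : ℝ := Real.log (2 * 𝒩.card) + v / 2 with hL
  set X : α → (ι → Bool) → ℝ := fun j s => ∑ i, boolSign (s i) * b j i with hX
  have hexp : Real.exp L = 2 * 𝒩.card * Real.exp (v / 2) := by
    rw [hL, Real.exp_add, Real.exp_log hN]
  -- The tangent inequality `x ≤ L - 1 + exp (x - L)` replaces Jensen for the logarithm; the sum
  -- over `𝒩` removes the dependence on the selector.
  have hpt : ∀ s, |X (J s) s| ≤
      L - 1 + Real.exp (-L) * ∑ j ∈ 𝒩, (Real.exp (X j s) + Real.exp (-X j s)) := by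
    intro s
    have h1 := Real.add_one_le_exp (|X (J s) s| - L)
    have h2 : Real.exp |X (J s) s| ≤ ∑ j ∈ 𝒩, (Real.exp (X j s) + Real.exp (-X j s)) := by
      refine le_trans ?_ (Finset.single_le_sum
        (f := fun j => Real.exp (X j s) + Real.exp (-X j s))
        (fun j _ => (add_pos (Real.exp_pos _) (Real.exp_pos _)).le) (hJ s))
      rcases abs_cases (X (J s) s) with ⟨h, -⟩ | ⟨h, -⟩ <;> rw [h]
      · linarith [Real.exp_pos (-X (J s) s)]
      · linarith [Real.exp_pos (X (J s) s)]
    have h3 : Real.exp (|X (J s) s| - L) = Real.exp (-L) * Real.exp |X (J s) s| := by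
      rw [← Real.exp_add]
      ring_nf
    have h4 := mul_le_mul_of_nonneg_left h2 (Real.exp_pos (-L)).le
    linarith
  have hmgf : ∀ j ∈ 𝒩, (𝔼 s, (Real.exp (X j s) + Real.exp (-X j s))) ≤ 2 * Real.exp (v / 2) := by
    intro j hj
    have hle : Real.exp ((∑ i, b j i ^ 2) / 2) ≤ Real.exp (v / 2) :=
      Real.exp_le_exp.2 (by linarith [hv j hj])
    have h1 := (expect_exp_sum_boolSign_le (b j)).trans hle
    have h2 := expect_exp_sum_boolSign_le (fun i => -b j i)
    simp only [mul_neg, Finset.sum_neg_distrib, neg_sq] at h2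
    rw [Finset.expect_add_distrib]
    linarith [h2.trans hle]
  calc (𝔼 s, |X (J s) s|)
      ≤ 𝔼 s, (L - 1 + Real.exp (-L) * ∑ j ∈ 𝒩, (Real.exp (X j s) + Real.exp (-X j s))) :=
        Finset.expect_le_expect fun s _ => hpt s
    _ = L - 1 + Real.exp (-L) * ∑ j ∈ 𝒩, 𝔼 s, (Real.exp (X j s) + Real.exp (-X j s)) := by
        rw [Finset.expect_add_distrib, Finset.expect_const Finset.univ_nonempty,
          ← Finset.mul_expect, Finset.expect_sum_comm]
    _ ≤ L - 1 + Real.exp (-L) * ∑ j ∈ 𝒩, 2 * Real.exp (v / 2) := by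
        gcongr with j hj
        exact hmgf j hj
    _ = L := by
        have hcard : (𝒩.card : ℝ) ≠ 0 := fun h => by simp [h] at hN
        rw [Finset.sum_const, nsmul_eq_mul, Real.exp_neg, hexp]
        field_simp
        ring

/-- The maximal inequality for the increments of a Rademacher process indexed by sets. -/
theorem expect_abs_increment_le {ι : Type*} [Fintype ι] [DecidableEq ι]
    (𝒩 : Finset (Finset ι)) (a : ι → ℝ) (q : Finset ι → Finset ι) {v l : ℝ} (hl : 0 < l)
    (hq : ∀ A ∈ 𝒩, ∑ i ∈ symmDiff A (q A), a i ^ 2 ≤ v) (A : (ι → Bool) → Finset ι)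
    (hA : ∀ s, A s ∈ 𝒩) :
    (𝔼 s : ι → Bool, |(∑ i ∈ A s, boolSign (s i) * a i) -
      ∑ i ∈ q (A s), boolSign (s i) * a i|) ≤ Real.log (2 * 𝒩.card) / l + l * v / 2 := by
  set b : Finset ι → ι → ℝ := fun B i =>
    l * (((if i ∈ B then 1 else 0) - (if i ∈ q B then 1 else 0)) * a i) with hb
  have h1 := expect_abs_selector_le 𝒩 b (v := l ^ 2 * v) (fun B hB => by
    calc ∑ i, b B i ^ 2 = l ^ 2 * ∑ i ∈ symmDiff B (q B), a i ^ 2 := by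
          rw [Finset.mul_sum, ← Finset.sum_subset (Finset.subset_univ (symmDiff B (q B)))]
          · refine Finset.sum_congr rfl fun i hi => ?_
            rcases Finset.mem_symmDiff.1 hi with h | h <;> simp [hb, h.1, h.2] <;> ring
          · intro i _ hi
            by_cases h : i ∈ B <;> by_cases h' : i ∈ q B <;>
              simp_all [Finset.mem_symmDiff]
      _ ≤ _ := mul_le_mul_of_nonneg_left (hq B hB) (by positivity)) A hA
  have h2 : ∀ s : ι → Bool, |∑ i, boolSign (s i) * b (A s) i| =
      l * |(∑ i ∈ A s, boolSign (s i) * a i) - ∑ i ∈ q (A s), boolSign (s i) * a i| := by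
    intro s
    have hind : ∀ B : Finset ι, ∑ i ∈ B, boolSign (s i) * a i =
        ∑ i, (if i ∈ B then 1 else 0) * (boolSign (s i) * a i) := fun B => by simp
    have hsum : ∑ i, boolSign (s i) * b (A s) i = l * ((∑ i ∈ A s, boolSign (s i) * a i) -
        ∑ i ∈ q (A s), boolSign (s i) * a i) := by
      rw [hind (A s), hind (q (A s)), ← Finset.sum_sub_distrib, Finset.mul_sum]
      refine Finset.sum_congr rfl fun i _ => ?_
      simp only [hb]
      ring
    rw [hsum, abs_mul, abs_of_pos hl]
  simp_rw [h2] at h1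
  rw [← Finset.mul_expect] at h1
  have h3 : Real.log (2 * 𝒩.card) / l + l * v / 2 =
      (Real.log (2 * 𝒩.card) + l ^ 2 * v / 2) / l := by
    field_simp
  rw [h3, le_div_iff₀ hl]
  linarith

/-- Chaining along the nets of a VC class: the bound for selectors with values in a net. -/
theorem expect_abs_le_of_net {ι : Type*} [Fintype ι] [DecidableEq ι] (a : ι → ℝ)
    {D : ℕ} (hD : 1 ≤ D) {t : ℝ} (ht : 0 < t) (𝒩 : ℕ → Finset (Finset ι))
    (hcard : ∀ k, Real.log (𝒩 k).card ≤ D * (4 + 3 * k))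
    (q : ℕ → Finset ι → Finset ι) (hqmem : ∀ k, ∀ A ∈ 𝒩 (k + 1), q k A ∈ 𝒩 k)
    (hq : ∀ k, ∀ A ∈ 𝒩 (k + 1),
      ∑ i ∈ symmDiff A (q k A), a i ^ 2 ≤ (1 / 4) ^ k * ∑ i, a i ^ 2)
    (k : ℕ) (A : (ι → Bool) → Finset ι) (hA : ∀ s, A s ∈ 𝒩 k) :
    (𝔼 s : ι → Bool, |∑ i ∈ A s, boolSign (s i) * a i|) ≤
      D * t * (27 - (22 + 6 * k) * (1 / 2) ^ k) +
        (∑ i, a i ^ 2) / t * (3 / 2 - (1 / 2) ^ k) := by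
  have hD0 : (1 : ℝ) ≤ D := by exact_mod_cast hD
  have hV : 0 ≤ ∑ i, a i ^ 2 := Finset.sum_nonneg fun i _ => sq_nonneg _
  have hlog : ∀ k, (𝒩 k).Nonempty →
      Real.log (2 * (𝒩 k).card) ≤ D * (5 + 3 * k) := by
    intro k hk
    have h0 : (0 : ℝ) < (𝒩 k).card := by exact_mod_cast hk.card_pos
    rw [Real.log_mul two_ne_zero h0.ne']
    nlinarith [hcard k, Real.log_two_lt_d9]
  -- The base case takes `l = 1 / t`, the passage from net `k` to net `k + 1` takes `l = 2 ^ k / t`.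
  -- The latter costs `D t (8 + 3k) 2⁻ᵏ + (V / t) 2⁻ᵏ / 2` with `V = ∑ aᵢ²`, exactly the increment
  -- of the stated bound.
  induction k generalizing A with
  | zero =>
    have h1 := expect_abs_increment_le (𝒩 0) a (fun _ => ∅) (v := ∑ i, a i ^ 2) (inv_pos.2 ht)
      (fun B _ => Finset.sum_le_sum_of_subset_of_nonneg (Finset.subset_univ _)
        fun i _ _ => sq_nonneg _) A hA
    simp only [Finset.sum_empty, sub_zero, div_inv_eq_mul] at h1
    refine h1.trans ?_
    have h2 := hlog 0 ⟨_, hA fun _ => true⟩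
    have h3 := mul_le_mul_of_nonneg_right h2 ht.le
    have h4 : t⁻¹ * (∑ i, a i ^ 2) / 2 = (∑ i, a i ^ 2) / t * (1 / 2) := by ring
    rw [h4]
    norm_num at h3 ⊢
    linarith
  | succ k ih =>
    have h2k : (0 : ℝ) < 2 ^ k := by positivity
    have h1 := expect_abs_increment_le (𝒩 (k + 1)) a (q k) (l := 2 ^ k / t) (by positivity)
      (hq k) A hA
    have h2 := ih (fun s => q k (A s)) fun s => hqmem k _ (hA s)
    have h3 := hlog (k + 1) ⟨_, hA fun _ => true⟩
    push_cast at h3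
    have h4 : Real.log (2 * (𝒩 (k + 1)).card) / (2 ^ k / t) ≤
        D * t * ((8 + 3 * k) * (1 / 2) ^ k) := by
      rw [div_div_eq_mul_div, div_le_iff₀ h2k]
      have h5 : D * t * ((8 + 3 * k) * (1 / 2) ^ k) * 2 ^ k = D * (5 + 3 * (k + 1 : ℝ)) * t := by
        rw [one_div, inv_pow]
        field_simp
        ring
      rw [h5]
      exact mul_le_mul_of_nonneg_right h3 ht.le
    have h6 : 2 ^ k / t * ((1 / 4) ^ k * ∑ i, a i ^ 2) / 2 =
        (∑ i, a i ^ 2) / t * ((1 / 2) ^ k / 2) := by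
      have : (2 : ℝ) ^ k * (1 / 4) ^ k = (1 / 2) ^ k := by
        rw [← mul_pow]
        norm_num
      rw [← this]
      ring
    calc (𝔼 s : ι → Bool, |∑ i ∈ A s, boolSign (s i) * a i|)
        ≤ 𝔼 s : ι → Bool, (|(∑ i ∈ A s, boolSign (s i) * a i) -
            ∑ i ∈ q k (A s), boolSign (s i) * a i| +
            |∑ i ∈ q k (A s), boolSign (s i) * a i|) :=
          Finset.expect_le_expect fun s _ => by
            simpa using abs_add_le ((∑ i ∈ A s, boolSign (s i) * a i) -
              ∑ i ∈ q k (A s), boolSign (s i) * a i) (∑ i ∈ q k (A s), boolSign (s i) * a i)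
      _ ≤ _ := by
          rw [Finset.expect_add_distrib]
          rw [h6] at h1
          have h7 : (D : ℝ) * t * ((8 + 3 * k) * (1 / 2) ^ k) +
              (∑ i, a i ^ 2) / t * ((1 / 2) ^ k / 2) +
              (D * t * (27 - (22 + 6 * k) * (1 / 2) ^ k) +
                (∑ i, a i ^ 2) / t * (3 / 2 - (1 / 2) ^ k)) =
              D * t * (27 - (22 + 6 * (k + 1 : ℕ)) * (1 / 2) ^ (k + 1)) +
                (∑ i, a i ^ 2) / t * (3 / 2 - (1 / 2) ^ (k + 1)) := by
            push_cast
            ring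
          linarith

/-- The expected supremum of a Rademacher process indexed by a VC class. -/
theorem expect_abs_le_of_shatters {ι : Type*} [Fintype ι] [DecidableEq ι]
    (𝒜 : Finset (Finset ι)) {D : ℕ} (hD : 1 ≤ D) (hvc : ∀ B, 𝒜.Shatters B → B.card ≤ D)
    (a : ι → ℝ) {t : ℝ} (ht : 0 < t) (A : (ι → Bool) → Finset ι) (hA : ∀ s, A s ∈ 𝒜) :
    (𝔼 s : ι → Bool, |∑ i ∈ A s, boolSign (s i) * a i|) ≤
      27 * (D * t) + 3 / 2 * ((∑ i, a i ^ 2) / t) := by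
  have hD0 : (1 : ℝ) ≤ D := by exact_mod_cast hD
  have hV : 0 ≤ ∑ i, a i ^ 2 := Finset.sum_nonneg fun i _ => sq_nonneg _
  rcases hV.eq_or_lt with hV0 | hVpos
  · have ha : ∀ i, a i = 0 := fun i => by
      have := (Finset.sum_eq_zero_iff_of_nonneg fun i _ => sq_nonneg (a i)).1 hV0.symm i
        (Finset.mem_univ i)
      exact pow_eq_zero_iff two_ne_zero |>.1 this
    simp only [ha, mul_zero, Finset.sum_const_zero, abs_zero]
    rw [Finset.expect_const Finset.univ_nonempty]
    positivity
  set V : ℝ := ∑ i, a i ^ 2 with hVdef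
  -- With these probability weights, the variance of an increment is `V` times the measure of a
  -- symmetric difference, so nets at scale `(1 / 4) ^ k` serve for the chaining.
  set w : ι → ℝ := fun i => a i ^ 2 / V with hw
  have hw0 : ∀ i, 0 ≤ w i := fun i => by positivity
  have hw1 : ∑ i, w i = 1 := by rw [hw, ← Finset.sum_div, div_self hVpos.ne']
  have hnet := fun k : ℕ => exists_separated_net (fun A B : Finset ι => ∑ i ∈ symmDiff A B, w i)
    (fun A B => by rw [symmDiff_comm]) (fun A => by simp) (ε := (1 / 4) ^ k) (by positivity) 𝒜
  choose 𝒩 hsub hsep hcov using hnet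
  have hcov' : ∀ k, ∀ A : Finset ι, ∃ B, A ∈ 𝒜 →
      B ∈ 𝒩 k ∧ ∑ i ∈ symmDiff A B, a i ^ 2 ≤ (1 / 4) ^ k * V := by
    intro k A
    by_cases hA : A ∈ 𝒜
    · obtain ⟨B, hB, hAB⟩ := hcov k A hA
      refine ⟨B, fun _ => ⟨hB, ?_⟩⟩
      rwa [hw, ← Finset.sum_div, div_le_iff₀ hVpos] at hAB
    · exact ⟨∅, fun h => absurd h hA⟩
  choose q hq using hcov'
  have hcard : ∀ k, Real.log (𝒩 k).card ≤ D * (4 + 3 * k) := by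
    intro k
    refine (log_card_le_of_separated w hw0 hw1 (ε := (1 / 4) ^ k) (by positivity)
      (pow_le_one₀ (by norm_num) (by norm_num)) (𝒩 k) (hsep k) hD
      fun B hB => hvc B (hB.mono_left (hsub k))).trans ?_
    refine mul_le_mul_of_nonneg_left ?_ (by linarith)
    have h1 : Real.log (1 / (1 / 4) ^ k) = k * (2 * Real.log 2) := by
      rw [one_div, ← inv_pow, Real.log_pow, show ((1 : ℝ) / 4)⁻¹ = 2 ^ 2 by norm_num, Real.log_pow]
      norm_num
    rw [h1]
    nlinarith [Real.log_two_lt_d9, (Nat.cast_nonneg k : (0 : ℝ) ≤ k)]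
  -- The first term is the cost of projecting onto the `k`-th net, with the crude cardinality of
  -- `𝒜`; it vanishes as `k → ∞`.
  have hbound : ∀ k : ℕ, (𝔼 s : ι → Bool, |∑ i ∈ A s, boolSign (s i) * a i|) ≤
      (Real.log (2 * 𝒜.card) + V / 2) * (1 / 2) ^ k + (27 * (D * t) + 3 / 2 * (V / t)) := by
    intro k
    have h1 := expect_abs_increment_le 𝒜 a (q k) (l := 2 ^ k) (by positivity)
      (fun B hB => (hq k B hB).2) A hA
    have h2 := expect_abs_le_of_net a hD ht 𝒩 hcard q
      (fun k A hA => (hq k A (hsub _ hA)).1) (fun k A hA => (hq k A (hsub _ hA)).2) k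
      (fun s => q k (A s)) fun s => (hq k _ (hA s)).1
    have h3 : Real.log (2 * 𝒜.card) / 2 ^ k + 2 ^ k * ((1 / 4) ^ k * V) / 2 =
        (Real.log (2 * 𝒜.card) + V / 2) * (1 / 2) ^ k := by
      have : (2 : ℝ) ^ k * (1 / 4) ^ k = (1 / 2) ^ k := by
        rw [← mul_pow]
        norm_num
      rw [← mul_assoc, this, one_div, inv_pow]
      ring
    have h4 : D * t * (27 - (22 + 6 * k) * (1 / 2) ^ k) + V / t * (3 / 2 - (1 / 2) ^ k) ≤
        27 * (D * t) + 3 / 2 * (V / t) := by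
      have h5 : 0 ≤ D * t * ((22 + 6 * k) * (1 / 2) ^ k) := by positivity
      have h6 : 0 ≤ V / t * (1 / 2) ^ k := by positivity
      linarith
    calc (𝔼 s : ι → Bool, |∑ i ∈ A s, boolSign (s i) * a i|)
        ≤ 𝔼 s : ι → Bool, (|(∑ i ∈ A s, boolSign (s i) * a i) -
            ∑ i ∈ q k (A s), boolSign (s i) * a i| +
            |∑ i ∈ q k (A s), boolSign (s i) * a i|) :=
          Finset.expect_le_expect fun s _ => by
            simpa using abs_add_le ((∑ i ∈ A s, boolSign (s i) * a i) -
              ∑ i ∈ q k (A s), boolSign (s i) * a i) (∑ i ∈ q k (A s), boolSign (s i) * a i)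
      _ ≤ _ := by
          rw [Finset.expect_add_distrib]
          linarith
  have hlim : Filter.Tendsto (fun k : ℕ => (Real.log (2 * 𝒜.card) + V / 2) * (1 / 2 : ℝ) ^ k +
      (27 * (D * t) + 3 / 2 * (V / t))) Filter.atTop (nhds (27 * (D * t) + 3 / 2 * (V / t))) := by
    simpa using ((tendsto_pow_atTop_nhds_zero_of_lt_one (r := (1 / 2 : ℝ)) (by norm_num)
      (by norm_num)).const_mul (Real.log (2 * 𝒜.card) + V / 2)).add_const
        (27 * (D * t) + 3 / 2 * (V / t))
  exact ge_of_tendsto' hlim hbound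

/-- The expected supremum of a Rademacher process indexed by a VC class, in terms of the `p`-th
moments of the weights. -/
theorem expect_abs_le_rpow {ι : Type*} [Fintype ι] [DecidableEq ι]
    (𝒜 : Finset (Finset ι)) {D : ℕ} (hD : 1 ≤ D) (hvc : ∀ B, 𝒜.Shatters B → B.card ≤ D)
    (a : ι → ℝ) {t p : ℝ} (ht : 0 < t) (hp1 : 1 ≤ p) (hp2 : p ≤ 2) (A : (ι → Bool) → Finset ι)
    (hA : ∀ s, A s ∈ 𝒜) :
    (𝔼 s : ι → Bool, |∑ i ∈ A s, boolSign (s i) * a i|) ≤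
      27 * (D * t) + 3 / 2 * (t ^ (1 - p) * ∑ i, |a i| ^ p) := by
  set b : ι → ℝ := fun i => if |a i| ≤ t then a i else 0 with hb
  set c : ι → ℝ := fun i => if |a i| ≤ t then 0 else |a i| with hc
  -- Below `t` this uses `p ≤ 2`, above `t` it uses `1 ≤ p`.
  have hbc : ∀ i, 3 / 2 * (b i ^ 2 / t) + c i ≤ 3 / 2 * (t ^ (1 - p) * |a i| ^ p) := by
    intro i
    by_cases h : |a i| ≤ t
    · simp only [hb, hc, if_pos h, add_zero]
      gcongr
      rcases (abs_nonneg (a i)).eq_or_lt with h0 | h0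
      · rw [← sq_abs, ← h0]
        simp only [ne_eq, OfNat.ofNat_ne_zero, not_false_eq_true, zero_pow, zero_div]
        positivity
      · rw [div_le_iff₀ ht, ← sq_abs, Real.rpow_sub ht, Real.rpow_one, ← Real.rpow_two,
          show (2 : ℝ) = p + (2 - p) by ring, Real.rpow_add h0]
        have h1 : |a i| ^ (2 - p) ≤ t ^ (2 - p) := Real.rpow_le_rpow h0.le h (by linarith)
        have h2 : t / t ^ p * |a i| ^ p * t = |a i| ^ p * t ^ (2 - p) := by
          rw [Real.rpow_sub ht, Real.rpow_two]
          ring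
        rw [h2]
        exact mul_le_mul_of_nonneg_left h1 (by positivity)
    · have h' := not_le.1 h
      have h0 : 0 < |a i| := ht.trans h'
      simp only [hb, hc, if_neg h]
      have h1 : |a i| ≤ t ^ (1 - p) * |a i| ^ p := by
        have h2 : t ^ (p - 1) ≤ |a i| ^ (p - 1) := Real.rpow_le_rpow ht.le h'.le (by linarith)
        rw [show (1 - p) = -(p - 1) by ring, Real.rpow_neg ht.le, inv_mul_eq_div,
          le_div_iff₀ (by positivity)]
        calc |a i| * t ^ (p - 1) ≤ |a i| * |a i| ^ (p - 1) :=
              mul_le_mul_of_nonneg_left h2 h0.le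
          _ = |a i| ^ p := by
              rw [Real.rpow_sub h0, Real.rpow_one]
              field_simp
      simp only [ne_eq, OfNat.ofNat_ne_zero, not_false_eq_true, zero_pow, zero_div, mul_zero,
        zero_add]
      linarith
  have hpt : ∀ s : ι → Bool, |∑ i ∈ A s, boolSign (s i) * a i| ≤
      |∑ i ∈ A s, boolSign (s i) * b i| + ∑ i, c i := by
    intro s
    have h1 : ∑ i ∈ A s, boolSign (s i) * a i = ∑ i ∈ A s, boolSign (s i) * b i +
        ∑ i ∈ A s, boolSign (s i) * (a i - b i) := by
      rw [← Finset.sum_add_distrib]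
      exact Finset.sum_congr rfl fun i _ => by ring
    have h2 : |∑ i ∈ A s, boolSign (s i) * (a i - b i)| ≤ ∑ i, c i := by
      refine (Finset.abs_sum_le_sum_abs _ _).trans ?_
      calc ∑ i ∈ A s, |boolSign (s i) * (a i - b i)| = ∑ i ∈ A s, c i := by
            refine Finset.sum_congr rfl fun i _ => ?_
            rw [abs_mul, abs_boolSign, one_mul]
            by_cases h : |a i| ≤ t <;> simp [hb, hc, h]
        _ ≤ ∑ i, c i := Finset.sum_le_sum_of_subset_of_nonneg (Finset.subset_univ _)
            fun i _ _ => by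
              simp only [hc]
              split_ifs <;> positivity
    rw [h1]
    exact (abs_add_le _ _).trans (by linarith)
  calc (𝔼 s : ι → Bool, |∑ i ∈ A s, boolSign (s i) * a i|)
      ≤ 𝔼 s : ι → Bool, (|∑ i ∈ A s, boolSign (s i) * b i| + ∑ i, c i) :=
        Finset.expect_le_expect fun s _ => hpt s
    _ ≤ 27 * (D * t) + 3 / 2 * ((∑ i, b i ^ 2) / t) + ∑ i, c i := by
        rw [Finset.expect_add_distrib, Finset.expect_const Finset.univ_nonempty]
        linarith [expect_abs_le_of_shatters 𝒜 hD hvc b ht A hA]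
    _ = 27 * (D * t) + ∑ i, (3 / 2 * (b i ^ 2 / t) + c i) := by
        rw [Finset.sum_add_distrib, ← Finset.mul_sum, ← Finset.sum_div]
        ring
    _ ≤ 27 * (D * t) + ∑ i, 3 / 2 * (t ^ (1 - p) * |a i| ^ p) := by
        gcongr with i
        exact hbc i
    _ = _ := by rw [← Finset.mul_sum, ← Finset.mul_sum]

/-! ### Symmetrization -/

/-- The largest absolute partial sum of `v` over the sets of the class `𝒜`. -/
noncomputable def maxPartialSum {ι : Type*} (𝒜 : Finset (Finset ι)) (h𝒜 : 𝒜.Nonempty)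
    (v : ι → ℝ) : ℝ :=
  𝒜.sup' h𝒜 fun A => |∑ i ∈ A, v i|

section

variable {ι : Type*} {𝒜 : Finset (Finset ι)} (h𝒜 : 𝒜.Nonempty)

theorem abs_sum_le_maxPartialSum {A : Finset ι} (hA : A ∈ 𝒜) (v : ι → ℝ) :
    |∑ i ∈ A, v i| ≤ maxPartialSum 𝒜 h𝒜 v :=
  Finset.le_sup' (fun A => |∑ i ∈ A, v i|) hA

theorem exists_eq_maxPartialSum (v : ι → ℝ) :
    ∃ A ∈ 𝒜, maxPartialSum 𝒜 h𝒜 v = |∑ i ∈ A, v i| :=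
  Finset.exists_mem_eq_sup' h𝒜 _

theorem maxPartialSum_nonneg (v : ι → ℝ) : 0 ≤ maxPartialSum 𝒜 h𝒜 v := by
  obtain ⟨A, -, hA⟩ := exists_eq_maxPartialSum h𝒜 v
  rw [hA]
  exact abs_nonneg _

theorem maxPartialSum_le_sum_abs [Fintype ι] (v : ι → ℝ) :
    maxPartialSum 𝒜 h𝒜 v ≤ ∑ i, |v i| := by
  obtain ⟨A, -, hA⟩ := exists_eq_maxPartialSum h𝒜 v
  rw [hA]
  exact (Finset.abs_sum_le_sum_abs _ _).trans
    (Finset.sum_le_sum_of_subset_of_nonneg (Finset.subset_univ _) fun i _ _ => abs_nonneg _)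

theorem maxPartialSum_add_le (u v : ι → ℝ) :
    maxPartialSum 𝒜 h𝒜 (u + v) ≤ maxPartialSum 𝒜 h𝒜 u + maxPartialSum 𝒜 h𝒜 v := by
  obtain ⟨A, hA, h⟩ := exists_eq_maxPartialSum h𝒜 (u + v)
  rw [h]
  simp only [Pi.add_apply, Finset.sum_add_distrib]
  exact (abs_add_le _ _).trans
    (add_le_add (abs_sum_le_maxPartialSum h𝒜 hA u) (abs_sum_le_maxPartialSum h𝒜 hA v))

theorem maxPartialSum_neg (v : ι → ℝ) : maxPartialSum 𝒜 h𝒜 (-v) = maxPartialSum 𝒜 h𝒜 v := by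
  simp [maxPartialSum]

theorem measurable_maxPartialSum : Measurable (maxPartialSum 𝒜 h𝒜) := by
  have : Measurable (𝒜.sup' h𝒜 fun A => fun v : ι → ℝ => |∑ i ∈ A, v i|) :=
    Finset.measurable_sup' h𝒜 fun A _ => by fun_prop
  convert this using 1
  ext v
  rw [Finset.sup'_apply]
  rfl

variable {Ω : Type*} [MeasurableSpace Ω] {μ : Measure Ω}

theorem integrable_maxPartialSum [Fintype ι] {X : Ω → ι → ℝ}
    (hX : ∀ i, Integrable (fun ω => X ω i) μ) :
    Integrable (fun ω => maxPartialSum 𝒜 h𝒜 (X ω)) μ := by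
  refine Integrable.mono' (integrable_finsetSum Finset.univ fun i _ => (hX i).abs) ?_
    (ae_of_all _ fun ω => ?_)
  · exact ((measurable_maxPartialSum h𝒜).comp_aemeasurable
      (aemeasurable_pi_lambda _ fun i => (hX i).aemeasurable)).aestronglyMeasurable
  · rw [Real.norm_of_nonneg (maxPartialSum_nonneg h𝒜 _)]
    exact maxPartialSum_le_sum_abs h𝒜 _

/-- Adding an independent centered vector increases the expectation. -/
theorem integral_maxPartialSum_le_add [Fintype ι] [IsProbabilityMeasure μ] {X W : Ω → ι → ℝ}
    (hXm : Measurable X) (hWm : Measurable W)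
    (hX : ∀ i, Integrable (fun ω => X ω i) μ) (hW : ∀ i, Integrable (fun ω => W ω i) μ)
    (hW0 : ∀ i, ∫ ω, W ω i ∂μ = 0) (hind : IndepFun X W μ) :
    ∫ ω, maxPartialSum 𝒜 h𝒜 (X ω) ∂μ ≤ ∫ ω, maxPartialSum 𝒜 h𝒜 (X ω + W ω) ∂μ := by
  have hZ := measurable_maxPartialSum h𝒜
  have hXW : Integrable (fun ω => maxPartialSum 𝒜 h𝒜 (X ω + W ω)) μ :=
    integrable_maxPartialSum h𝒜 (X := fun ω => X ω + W ω) fun i => (hX i).add (hW i)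
  -- Jensen, for the set `A` attaining the maximum at `x`; independence and Fubini then integrate it
  -- over the law of `X`.
  have hjensen : ∀ x : ι → ℝ, maxPartialSum 𝒜 h𝒜 x ≤ ∫ ω, maxPartialSum 𝒜 h𝒜 (x + W ω) ∂μ := by
    intro x
    obtain ⟨A, hA, h⟩ := exists_eq_maxPartialSum h𝒜 x
    have hxW : ∀ i, Integrable (fun ω => x i + W ω i) μ := fun i =>
      (integrable_const _).add (hW i)
    have h1 : ∑ i ∈ A, x i = ∫ ω, ∑ i ∈ A, (x i + W ω i) ∂μ := by
      rw [integral_finsetSum A fun i _ => hxW i]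
      refine Finset.sum_congr rfl fun i _ => ?_
      rw [integral_add (integrable_const _) (hW i), hW0]
      simp
    rw [h, h1]
    refine abs_integral_le_integral_abs.trans (integral_mono ?_ ?_ fun ω => ?_)
    · exact (integrable_finsetSum A fun i _ => hxW i).abs
    · exact integrable_maxPartialSum h𝒜 (X := fun ω => x + W ω) hxW
    · exact abs_sum_le_maxPartialSum h𝒜 hA (x + W ω)
  have hmap := (indepFun_iff_map_prod_eq_prod_map_map hXm.aemeasurable hWm.aemeasurable).1 hind
  have hadd : Measurable fun z : (ι → ℝ) × (ι → ℝ) => maxPartialSum 𝒜 h𝒜 (z.1 + z.2) :=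
    hZ.comp (measurable_fst.add measurable_snd)
  have : IsProbabilityMeasure (μ.map X) := Measure.isProbabilityMeasure_map hXm.aemeasurable
  have : IsProbabilityMeasure (μ.map W) := Measure.isProbabilityMeasure_map hWm.aemeasurable
  have hprodint : Integrable (fun z : (ι → ℝ) × (ι → ℝ) => maxPartialSum 𝒜 h𝒜 (z.1 + z.2))
      ((μ.map X).prod (μ.map W)) := by
    rw [← hmap, integrable_map_measure hadd.aestronglyMeasurable (hXm.prodMk hWm).aemeasurable]
    exact hXW
  calc ∫ ω, maxPartialSum 𝒜 h𝒜 (X ω) ∂μ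
      = ∫ x, maxPartialSum 𝒜 h𝒜 x ∂(μ.map X) :=
        (integral_map hXm.aemeasurable hZ.aestronglyMeasurable).symm
    _ ≤ ∫ x, ∫ w, maxPartialSum 𝒜 h𝒜 (x + w) ∂(μ.map W) ∂(μ.map X) := by
        refine integral_mono ?_ hprodint.integral_prod_left fun x => ?_
        · rw [integrable_map_measure hZ.aestronglyMeasurable hXm.aemeasurable]
          exact integrable_maxPartialSum h𝒜 hX
        · refine (hjensen x).trans (le_of_eq ?_)
          exact (integral_map hWm.aemeasurable
            (hZ.comp (measurable_const_add x)).aestronglyMeasurable).symm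
    _ = ∫ z, maxPartialSum 𝒜 h𝒜 (z.1 + z.2) ∂((μ.map X).prod (μ.map W)) :=
        (integral_prod _ hprodint).symm
    _ = ∫ ω, maxPartialSum 𝒜 h𝒜 (X ω + W ω) ∂μ := by
        rw [← hmap, integral_map (hXm.prodMk hWm).aemeasurable hadd.aestronglyMeasurable]

/-- Symmetrization, for a given choice of the signs. -/
theorem integral_maxPartialSum_le_two_mul [Fintype ι] [DecidableEq ι] [IsProbabilityMeasure μ]
    {ξ : ι → Ω → ℝ} (hm : ∀ i, Measurable (ξ i)) (hint : ∀ i, Integrable (ξ i) μ)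
    (h0 : ∀ i, ∫ ω, ξ i ω ∂μ = 0) (hind : iIndepFun ξ μ) (s : ι → Bool) :
    ∫ ω, maxPartialSum 𝒜 h𝒜 (fun i => ξ i ω) ∂μ ≤
      2 * ∫ ω, maxPartialSum 𝒜 h𝒜 (fun i => boolSign (s i) * ξ i ω) ∂μ := by
  -- No independent copy is needed: `ξ = P true + P false`, the signed vector is `P true - P false`,
  -- and the two halves are independent and centered. Each half is therefore dominated by the signed
  -- vector, hence the factor two.
  set P : Bool → Ω → ι → ℝ := fun b ω i => if s i = b then ξ i ω else 0 with hP
  have hPm : ∀ b, Measurable (P b) := fun b => measurable_pi_lambda _ fun i => by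
    by_cases h : s i = b <;> simp [hP, h, hm i]
  have hPi : ∀ b i, Integrable (fun ω => P b ω i) μ := fun b i => by
    by_cases h : s i = b <;> simp [hP, h, hint i]
  have hP0 : ∀ b i, ∫ ω, P b ω i ∂μ = 0 := fun b i => by
    by_cases h : s i = b <;> simp [hP, h, h0 i]
  have hPind : IndepFun (P true) (P false) μ := by
    have hdisj : Disjoint (Finset.univ.filter fun i => s i = true)
        (Finset.univ.filter fun i => s i = false) :=
      Finset.disjoint_filter.2 fun i _ h1 h2 => by simp [h1] at h2
    have h1 := hind.indepFun_finset _ _ hdisj hm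
    have hext : ∀ b, ∃ g : ((Finset.univ.filter fun i => s i = b) → ℝ) → ι → ℝ, Measurable g ∧
        P b = g ∘ fun ω i => ξ i ω := by
      intro b
      refine ⟨fun v i => if h : i ∈ Finset.univ.filter fun i => s i = b then v ⟨i, h⟩ else 0,
        measurable_pi_lambda _ fun i => ?_, ?_⟩
      · by_cases h : i ∈ Finset.univ.filter fun i => s i = b
        · simp only [dif_pos h]
          exact measurable_pi_apply _
        · simp only [dif_neg h]
          exact measurable_const
      · ext ω i
        simp [hP]
    obtain ⟨g1, hg1, e1⟩ := hext true
    obtain ⟨g2, hg2, e2⟩ := hext false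
    rw [e1, e2]
    exact h1.comp hg1 hg2
  have hneg : Measurable fun v : ι → ℝ => -v := measurable_neg
  have hstep1 := integral_maxPartialSum_le_add h𝒜 (hPm true) (hneg.comp (hPm false)) (hPi true)
    (fun i => (hPi false i).neg) (fun i => by
      simp only [Function.comp_apply, Pi.neg_apply, integral_neg, hP0, neg_zero])
    (hPind.comp measurable_id hneg)
  have hstep2 := integral_maxPartialSum_le_add h𝒜 (hPm false) (hneg.comp (hPm true)) (hPi false)
    (fun i => (hPi true i).neg) (fun i => by
      simp only [Function.comp_apply, Pi.neg_apply, integral_neg, hP0, neg_zero])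
    (hPind.symm.comp measurable_id hneg)
  have e1 : ∀ ω, P true ω + ((fun v : ι → ℝ => -v) ∘ P false) ω =
      fun i => boolSign (s i) * ξ i ω := fun ω => by
    ext i
    cases h : s i <;> simp [hP, boolSign, h]
  have e2 : ∀ ω, P false ω + ((fun v : ι → ℝ => -v) ∘ P true) ω =
      -fun i => boolSign (s i) * ξ i ω := fun ω => by
    ext i
    cases h : s i <;> simp [hP, boolSign, h]
  simp_rw [e1] at hstep1
  simp_rw [e2, maxPartialSum_neg] at hstep2
  have hsum : ∀ ω, (fun i => ξ i ω) = P true ω + P false ω := fun ω => by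
    ext i
    cases h : s i <;> simp [hP, h]
  calc ∫ ω, maxPartialSum 𝒜 h𝒜 (fun i => ξ i ω) ∂μ
      ≤ ∫ ω, (maxPartialSum 𝒜 h𝒜 (P true ω) + maxPartialSum 𝒜 h𝒜 (P false ω)) ∂μ := by
        refine integral_mono (integrable_maxPartialSum h𝒜 (X := fun ω i => ξ i ω) hint)
          ((integrable_maxPartialSum h𝒜 (hPi true)).add
            (integrable_maxPartialSum h𝒜 (hPi false))) fun ω => ?_
        simp only [hsum ω]
        exact maxPartialSum_add_le h𝒜 _ _
    _ ≤ _ := by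
        rw [integral_add (integrable_maxPartialSum h𝒜 (hPi true))
            (integrable_maxPartialSum h𝒜 (hPi false))]
        linarith

/-- The expected supremum of a centered process indexed by a VC class. -/
theorem integral_maxPartialSum_le [Fintype ι] [DecidableEq ι] [IsProbabilityMeasure μ]
    {D : ℕ} (hD : 1 ≤ D) (hvc : ∀ B, 𝒜.Shatters B → B.card ≤ D)
    {ξ : ι → Ω → ℝ} (hm : ∀ i, Measurable (ξ i)) (hint : ∀ i, Integrable (ξ i) μ)
    (h0 : ∀ i, ∫ ω, ξ i ω ∂μ = 0) (hind : iIndepFun ξ μ) {t p : ℝ} (ht : 0 < t)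
    (hp1 : 1 ≤ p) (hp2 : p ≤ 2) (hp : ∀ i, Integrable (fun ω => |ξ i ω| ^ p) μ) :
    ∫ ω, maxPartialSum 𝒜 h𝒜 (fun i => ξ i ω) ∂μ ≤
      54 * (D * t) + 3 * (t ^ (1 - p) * ∑ i, ∫ ω, |ξ i ω| ^ p ∂μ) := by
  have hint' : ∀ s : ι → Bool,
      Integrable (fun ω => maxPartialSum 𝒜 h𝒜 (fun i => boolSign (s i) * ξ i ω)) μ := fun s =>
    integrable_maxPartialSum h𝒜 (X := fun ω i => boolSign (s i) * ξ i ω)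
      fun i => (hint i).const_mul _
  have hpt : ∀ ω, (𝔼 s : ι → Bool, maxPartialSum 𝒜 h𝒜 (fun i => boolSign (s i) * ξ i ω)) ≤
      27 * (D * t) + 3 / 2 * (t ^ (1 - p) * ∑ i, |ξ i ω| ^ p) := by
    intro ω
    -- At fixed `ω`, the maximizing sets form the selector.
    choose A hA h using fun s : ι → Bool =>
      exists_eq_maxPartialSum h𝒜 (fun i => boolSign (s i) * ξ i ω)
    simp_rw [h]
    exact expect_abs_le_rpow 𝒜 hD hvc (fun i => ξ i ω) ht hp1 hp2 A hA
  have hsumint : Integrable (fun ω => ∑ i, |ξ i ω| ^ p) μ :=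
    integrable_finsetSum Finset.univ fun i _ => hp i
  calc ∫ ω, maxPartialSum 𝒜 h𝒜 (fun i => ξ i ω) ∂μ
      = 𝔼 _s : ι → Bool, ∫ ω, maxPartialSum 𝒜 h𝒜 (fun i => ξ i ω) ∂μ :=
        (Finset.expect_const Finset.univ_nonempty _).symm
    _ ≤ 𝔼 s : ι → Bool, 2 * ∫ ω, maxPartialSum 𝒜 h𝒜 (fun i => boolSign (s i) * ξ i ω) ∂μ :=
        Finset.expect_le_expect fun s _ =>
          integral_maxPartialSum_le_two_mul h𝒜 hm hint h0 hind s
    _ = 2 * ∫ ω, (𝔼 s : ι → Bool,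
          maxPartialSum 𝒜 h𝒜 (fun i => boolSign (s i) * ξ i ω)) ∂μ := by
        simp_rw [← Finset.mul_expect, Finset.expect_eq_sum_div_card]
        rw [integral_div, integral_finsetSum Finset.univ fun s _ => hint' s]
    _ ≤ 2 * ∫ ω, (27 * (D * t) + 3 / 2 * (t ^ (1 - p) * ∑ i, |ξ i ω| ^ p)) ∂μ := by
        refine mul_le_mul_of_nonneg_left (integral_mono ?_ ?_ hpt) zero_le_two
        · simp_rw [Finset.expect_eq_sum_div_card]
          exact (integrable_finsetSum Finset.univ fun s _ => hint' s).div_const _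
        · exact (integrable_const _).add ((hsumint.const_mul _).const_mul _)
    _ = _ := by
        rw [integral_add (integrable_const _) ((hsumint.const_mul _).const_mul _),
          integral_const, integral_const_mul, integral_const_mul,
          integral_finsetSum Finset.univ fun i _ => hp i]
        simp
        ring

end

/-! ### Deterministic analysis of the estimator -/

/-- The traces on the design points of the sets `{h > 0}`, for `h ∈ ℱ`. -/
noncomputable def positivityClass {𝒳 : Type*} {n : ℕ} (x : Fin n → 𝒳)
    (ℱ : Submodule ℝ (𝒳 → ℝ)) : Finset (Finset (Fin n)) :=
  open Classical in
  Finset.univ.filter fun A => ∃ h ∈ ℱ, ∀ i, i ∈ A ↔ 0 < h (x i)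

section

variable {𝒳 : Type*} {n : ℕ} (x : Fin n → 𝒳) (ℱ : Submodule ℝ (𝒳 → ℝ))

theorem mem_positivityClass {A : Finset (Fin n)} :
    A ∈ positivityClass x ℱ ↔ ∃ h ∈ ℱ, ∀ i, i ∈ A ↔ 0 < h (x i) := by
  simp [positivityClass]

theorem filter_mem_positivityClass {h : 𝒳 → ℝ} (hh : h ∈ ℱ) :
    (Finset.univ.filter fun i => 0 < h (x i)) ∈ positivityClass x ℱ :=
  (mem_positivityClass x ℱ).2 ⟨h, hh, by simp⟩

theorem positivityClass_nonempty : (positivityClass x ℱ).Nonempty :=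
  ⟨_, filter_mem_positivityClass x ℱ ℱ.zero_mem⟩

theorem card_le_of_shatters_positivityClass [FiniteDimensional ℝ ℱ] (B : Finset (Fin n))
    (hB : (positivityClass x ℱ).Shatters B) : B.card ≤ Module.finrank ℝ ℱ := by
  classical
  by_contra! hlt
  obtain ⟨s, hs⟩ := exists_set_forall_pos_ne
    ((LinearMap.funLeft ℝ ℝ (fun b : B => x b)).comp ℱ.subtype) (by rwa [Fintype.card_coe])
  obtain ⟨A, hA, hAB⟩ := hB (t := B.filter fun i => ∃ h : i ∈ B, (⟨i, h⟩ : B) ∈ s)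
    (Finset.filter_subset _ _)
  obtain ⟨h, hh, hhA⟩ := (mem_positivityClass x ℱ).1 hA
  refine hs ⟨h, hh⟩ ?_
  ext ⟨b, hb⟩
  have h1 := Finset.ext_iff.1 hAB b
  rw [Finset.mem_inter, Finset.mem_filter, hhA] at h1
  simpa [LinearMap.funLeft_apply, hb] using h1

/-- Since `f - y = (f - f⋆) - ξ` at the design points, the signs turn the noise into the difference
of its sums over `{g > f}` and `{f > g}`, both positivity sets by linearity: hence `2`. -/
theorem testStat_le (y : Fin n → ℝ) (fstar : 𝒳 → ℝ) {f g : 𝒳 → ℝ} (hf : f ∈ ℱ) (hg : g ∈ ℱ) :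
    testStat x y f g ≤ ∑ i, |fstar (x i) - f (x i)| +
      2 * maxPartialSum _ (positivityClass_nonempty x ℱ) (fun i => y i - fstar (x i)) := by
  set ξ : Fin n → ℝ := fun i => y i - fstar (x i) with hξ
  set A := Finset.univ.filter fun i => 0 < (f - g) (x i) with hA
  set B := Finset.univ.filter fun i => 0 < (g - f) (x i) with hB
  have h1 := abs_sum_le_maxPartialSum (positivityClass_nonempty x ℱ)
    (filter_mem_positivityClass x ℱ (ℱ.sub_mem hf hg)) ξ
  have h2 := abs_sum_le_maxPartialSum (positivityClass_nonempty x ℱ)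
    (filter_mem_positivityClass x ℱ (ℱ.sub_mem hg hf)) ξ
  rw [← hA] at h1
  rw [← hB] at h2
  have h3 : testStat x y f g ≤ ∑ i, |fstar (x i) - f (x i)| +
      (∑ i ∈ B, ξ i - ∑ i ∈ A, ξ i) := by
    rw [hA, hB, Finset.sum_filter, Finset.sum_filter, ← Finset.sum_sub_distrib,
      ← Finset.sum_add_distrib]
    refine Finset.sum_le_sum fun i _ => ?_
    have h4 := le_abs_self (fstar (x i) - f (x i))
    have h5 := neg_abs_le (fstar (x i) - f (x i))
    simp only [Pi.sub_apply, hξ]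
    rcases lt_trichotomy (f (x i)) (g (x i)) with h | h | h
    · rw [Real.sign_of_neg (by linarith), if_pos (by linarith), if_neg (by linarith)]
      linarith
    · rw [h]
      simp
    · rw [Real.sign_of_pos (by linarith), if_neg (by linarith), if_pos (by linarith)]
      linarith
  linarith [neg_abs_le (∑ i ∈ A, ξ i), le_abs_self (∑ i ∈ B, ξ i)]

/-- The sign is odd, so the data cancel. -/
theorem testStat_add_testStat_swap (y : Fin n → ℝ) (f g : 𝒳 → ℝ) :
    testStat x y f g + testStat x y g f = ∑ i, |f (x i) - g (x i)| := by
  rw [testStat, testStat, ← Finset.sum_add_distrib]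
  refine Finset.sum_congr rfl fun i _ => ?_
  rw [← neg_sub (f (x i)) (g (x i)), Real.sign_neg]
  rcases lt_trichotomy (f (x i) - g (x i)) 0 with h | h | h
  · rw [Real.sign_of_neg h, abs_of_neg h]
    ring
  · rw [h]
    simp
  · rw [Real.sign_of_pos h, abs_of_pos h]
    ring

/-- The deterministic bound on the loss of the estimator. -/
theorem loss_le_of_mem_estimatorSet (hn : 1 ≤ n) (y : Fin n → ℝ) (fstar : 𝒳 → ℝ) {c : ℝ}
    {f fhat : 𝒳 → ℝ} (hf : f ∈ ℱ) (hfhat : fhat ∈ estimatorSet x y (ℱ : Set (𝒳 → ℝ)) c) :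
    loss x fstar fhat ≤ 3 * loss x fstar f + 4 / n *
      maxPartialSum _ (positivityClass_nonempty x ℱ) (fun i => y i - fstar (x i)) + c / n := by
  have hn0 : (0 : ℝ) < n := by exact_mod_cast hn
  obtain ⟨hmem, hle⟩ := hfhat
  set Z := maxPartialSum _ (positivityClass_nonempty x ℱ) (fun i => y i - fstar (x i))
  have h1 : testStat x y fhat f ≤ supStat x y ℱ fhat :=
    le_csSup (bddAbove_testStat x y ℱ fhat) ⟨f, hf, rfl⟩
  have h2 : sInf (supStat x y ℱ '' ℱ) ≤ supStat x y ℱ f :=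
    csInf_le ⟨0, by rintro _ ⟨g, hg, rfl⟩; exact supStat_nonneg x y ℱ hg⟩ ⟨f, hf, rfl⟩
  have h3 : supStat x y ℱ f ≤ ∑ i, |fstar (x i) - f (x i)| + 2 * Z := by
    refine csSup_le ⟨_, f, hf, rfl⟩ ?_
    rintro _ ⟨g, hg, rfl⟩
    exact testStat_le x ℱ y fstar hf hg
  have h4 := testStat_le x ℱ y fstar hf hmem
  have h5 := testStat_add_testStat_swap x y fhat f
  have h6 : ∑ i, |fstar (x i) - fhat (x i)| ≤
      ∑ i, |fstar (x i) - f (x i)| + ∑ i, |fhat (x i) - f (x i)| := by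
    rw [← Finset.sum_add_distrib]
    refine Finset.sum_le_sum fun i _ => ?_
    rw [abs_sub_comm (fhat (x i))]
    exact abs_sub_le _ _ _
  -- Both `T(f̂, f) ≤ T(f) + c` and `T(f, f̂)` contribute one approximation error and `2 Z`; the
  -- triangle inequality adds the third error.
  have h7 : ∑ i, |fstar (x i) - fhat (x i)| ≤
      3 * ∑ i, |fstar (x i) - f (x i)| + 4 * Z + c := by linarith
  rw [loss, loss]
  calc 1 / (n : ℝ) * ∑ i, |fstar (x i) - fhat (x i)|
      ≤ 1 / (n : ℝ) * (3 * ∑ i, |fstar (x i) - f (x i)| + 4 * Z + c) :=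
        mul_le_mul_of_nonneg_left h7 (by positivity)
    _ = _ := by ring

end

/-! ### Choice of the threshold and the risk bound -/

theorem le_of_forall_threshold {D S z p : ℝ} (hD : 0 < D) (hS : 0 ≤ S) (hp : 1 ≤ p)
    (h : ∀ t > 0, z ≤ 54 * (D * t) + 3 * (t ^ (1 - p) * S)) :
    z ≤ 57 * (S ^ (1 / p) * D ^ (1 - 1 / p)) := by
  have hp0 : 0 < p := by linarith
  rcases hS.eq_or_lt with rfl | hSpos
  · have hz : z ≤ 0 := by
      refine le_of_forall_pos_le_add fun ε hε => ?_
      have h1 := h (ε / (54 * D)) (by positivity)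
      have h2 : 54 * (D * (ε / (54 * D))) = ε := by field_simp
      rw [h2, mul_zero, mul_zero] at h1
      linarith
    exact hz.trans (by positivity)
  · have h1 := h ((S / D) ^ (1 / p)) (by positivity)
    have htp : ((S / D) ^ (1 / p)) ^ p = S / D := by
      rw [← Real.rpow_mul (by positivity), one_div_mul_cancel hp0.ne', Real.rpow_one]
    have h2 : ((S / D) ^ (1 / p)) ^ (1 - p) * S = D * (S / D) ^ (1 / p) := by
      rw [Real.rpow_sub (by positivity), Real.rpow_one, htp]
      field_simp
    have h3 : D * (S / D) ^ (1 / p) = S ^ (1 / p) * D ^ (1 - 1 / p) := by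
      rw [Real.div_rpow hS hD.le, Real.rpow_sub hD, Real.rpow_one]
      ring
    rw [h2, h3] at h1
    linarith

theorem rpow_mul_rpow_div {S D n p : ℝ} (hS : 0 ≤ S) (hD : 0 ≤ D) (hn : 0 < n) :
    S ^ (1 / p) * D ^ (1 - 1 / p) / n = (n⁻¹ * S) ^ (1 / p) * (D / n) ^ (1 - 1 / p) := by
  rw [inv_mul_eq_div, Real.div_rpow hS hn.le, Real.div_rpow hD hn.le, div_mul_div_comm,
    ← Real.rpow_add hn]
  simp

theorem ofReal_integral_maxPartialSum_le {Ω : Type*} [MeasurableSpace Ω] {μ : Measure Ω}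
    [IsProbabilityMeasure μ] {n : ℕ} (hn : 1 ≤ n) {𝒜 : Finset (Finset (Fin n))}
    (h𝒜 : 𝒜.Nonempty) {D : ℕ} (hD : 1 ≤ D) (hvc : ∀ B, 𝒜.Shatters B → B.card ≤ D)
    {Y : Fin n → Ω → ℝ} (hm : ∀ i, Measurable (Y i)) (hind : iIndepFun Y μ)
    (hint : ∀ i, Integrable (Y i) μ) {p : ℝ} (hp1 : 1 ≤ p) (hp2 : p ≤ 2) :
    ENNReal.ofReal (4 / n * ∫ ω, maxPartialSum 𝒜 h𝒜 (fun i => Y i ω - ∫ ω', Y i ω' ∂μ) ∂μ) ≤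
      ENNReal.ofReal 228 *
        (noiseLevel μ Y p * ENNReal.ofReal (((D : ℝ) / (n : ℝ)) ^ (1 - 1 / p))) := by
  have hn0 : (0 : ℝ) < n := by exact_mod_cast hn
  have hD0 : (0 : ℝ) < D := by exact_mod_cast hD
  have hp0 : 0 < 1 / p := by
    have : 0 < p := by linarith
    positivity
  have hfac : 0 < ((D : ℝ) / (n : ℝ)) ^ (1 - 1 / p) := by positivity
  -- An infinite noise level makes the bound trivial, the other factor being positive; a finite one
  -- gives the `p`-th moments.
  by_cases htop : noiseLevel μ Y p = ⊤
  · rw [htop, ENNReal.top_mul (ENNReal.ofReal_pos.2 hfac).ne', ENNReal.mul_top (by norm_num)]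
    exact le_top
  set ξ : Fin n → Ω → ℝ := fun i ω => Y i ω - ∫ ω', Y i ω' ∂μ with hξ
  have hξm : ∀ i, Measurable (ξ i) := fun i => (hm i).sub_const _
  have hξp : ∀ i, AEStronglyMeasurable (fun ω => |ξ i ω| ^ p) μ := fun i =>
    ((measurable_norm.comp (hξm i)).pow_const p).aestronglyMeasurable
  have hsum : ∑ i, ∫⁻ ω, ENNReal.ofReal (|ξ i ω| ^ p) ∂μ ≠ ⊤ := by
    intro h
    refine htop ?_
    rw [noiseLevel, h, ENNReal.mul_top (by simp), ENNReal.top_rpow_of_pos hp0]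
  have hp : ∀ i, Integrable (fun ω => |ξ i ω| ^ p) μ := by
    intro i
    rw [← lintegral_ofReal_ne_top_iff_integrable (hξp i)
      (ae_of_all _ fun ω => Real.rpow_nonneg (abs_nonneg _) p)]
    exact (ENNReal.sum_ne_top.1 hsum) i (Finset.mem_univ i)
  set S : ℝ := ∑ i, ∫ ω, |ξ i ω| ^ p ∂μ with hS
  have hSi : ∀ i, 0 ≤ ∫ ω, |ξ i ω| ^ p ∂μ := fun i =>
    integral_nonneg fun ω => Real.rpow_nonneg (abs_nonneg _) p
  have hS0 : 0 ≤ S := Finset.sum_nonneg fun i _ => hSi i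
  have hnoise : noiseLevel μ Y p = ENNReal.ofReal (((n : ℝ)⁻¹ * S) ^ (1 / p)) := by
    rw [noiseLevel, ← ENNReal.ofReal_rpow_of_nonneg (by positivity) hp0.le,
      ENNReal.ofReal_mul (by positivity), ENNReal.ofReal_inv_of_pos hn0, ENNReal.ofReal_natCast,
      hS, ENNReal.ofReal_sum_of_nonneg fun i _ => hSi i]
    congr 2
    refine Finset.sum_congr rfl fun i _ => ?_
    rw [ofReal_integral_eq_lintegral_ofReal (hp i)
      (ae_of_all _ fun ω => Real.rpow_nonneg (abs_nonneg _) p)]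
  have hmain := le_of_forall_threshold hD0 hS0 hp1 fun t ht =>
    integral_maxPartialSum_le h𝒜 hD hvc hξm (fun i => (hint i).sub (integrable_const _))
      (fun i => by
        simp only [hξ]
        rw [integral_sub (hint i) (integrable_const _)]
        simp)
      (hind.comp (fun i y => y - ∫ ω', Y i ω' ∂μ) fun i => measurable_id.sub_const _)
      ht hp1 hp2 hp
  rw [hnoise, ← ENNReal.ofReal_mul (by positivity), ← ENNReal.ofReal_mul (by norm_num),
    ← rpow_mul_rpow_div hS0 hD0.le hn0]
  refine ENNReal.ofReal_le_ofReal ?_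
  calc 4 / n * ∫ ω, maxPartialSum 𝒜 h𝒜 (fun i => ξ i ω) ∂μ
      ≤ 4 / n * (57 * (S ^ (1 / p) * (D : ℝ) ^ (1 - 1 / p))) :=
        mul_le_mul_of_nonneg_left hmain (by positivity)
    _ = _ := by ring

theorem integrable_loss_and_ofReal_integral_le {𝒳 Ω : Type*} [MeasurableSpace Ω]
    {μ : Measure Ω} [IsProbabilityMeasure μ] {n : ℕ} (hn : 1 ≤ n) (x : Fin n → 𝒳)
    (fstar : 𝒳 → ℝ) {Y : Fin n → Ω → ℝ} (ℱ : Submodule ℝ (𝒳 → ℝ)) [FiniteDimensional ℝ ℱ]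
    {c : ℝ} (hc : 0 ≤ c) {fhat : Ω → 𝒳 → ℝ}
    (hm : ∀ i, Measurable (Y i)) (hind : iIndepFun Y μ) (hint : ∀ i, Integrable (Y i) μ)
    (hmean : ∀ i, ∫ ω, Y i ω ∂μ = fstar (x i))
    (hfhat : ∀ᵐ ω ∂μ, fhat ω ∈ estimatorSet x (fun i => Y i ω) (ℱ : Set (𝒳 → ℝ)) c)
    (hloss : AEMeasurable (fun ω => loss x fstar (fhat ω)) μ) :
    Integrable (fun ω => loss x fstar (fhat ω)) μ ∧
      ENNReal.ofReal (∫ ω, loss x fstar (fhat ω) ∂μ) ≤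
        3 * lossToSet x fstar (ℱ : Set (𝒳 → ℝ)) +
          ENNReal.ofReal 228 * (⨅ p ∈ Set.Icc (1 : ℝ) 2, noiseLevel μ Y p * ENNReal.ofReal
            ((((min (Module.finrank ℝ ℱ + 1) n : ℕ) : ℝ) / (n : ℝ)) ^ (1 - 1 / p))) +
          ENNReal.ofReal (c / n) := by
  have hn0 : (0 : ℝ) < n := by exact_mod_cast hn
  have hloss0 : ∀ f g : 𝒳 → ℝ, 0 ≤ loss x f g := fun f g =>
    mul_nonneg (by positivity) (Finset.sum_nonneg fun i _ => abs_nonneg _)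
  have hne := positivityClass_nonempty x ℱ
  set Z : Ω → ℝ := fun ω => maxPartialSum _ hne (fun i => Y i ω - fstar (x i)) with hZ
  have hZint : Integrable Z μ :=
    integrable_maxPartialSum hne (X := fun ω i => Y i ω - fstar (x i))
      fun i => (hint i).sub (integrable_const _)
  have hbound : ∀ f ∈ ℱ, ∀ᵐ ω ∂μ, loss x fstar (fhat ω) ≤
      3 * loss x fstar f + 4 / n * Z ω + c / n := fun f hf => by
    filter_upwards [hfhat] with ω hω
    exact loss_le_of_mem_estimatorSet x ℱ hn _ fstar hf hω
  have hbint : ∀ f : 𝒳 → ℝ, Integrable (fun ω => 3 * loss x fstar f + 4 / n * Z ω + c / n) μ :=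
    fun f => ((integrable_const _).add (hZint.const_mul _)).add (integrable_const _)
  have hI : Integrable (fun ω => loss x fstar (fhat ω)) μ := by
    -- The comparison with `f = 0` dominates the loss by an integrable variable.
    refine (hbint 0).mono' hloss.aestronglyMeasurable ?_
    filter_upwards [hbound 0 ℱ.zero_mem] with ω hω
    rwa [Real.norm_of_nonneg (hloss0 _ _)]
  refine ⟨hI, ?_⟩
  -- Both infima are pulled outside, so it suffices to bound the risk for each `f` and each `p`.
  rw [lossToSet, iInf_subtype', iInf_subtype',
    ENNReal.mul_iInf_of_ne (by norm_num) (by norm_num),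
    ENNReal.mul_iInf_of_ne (by norm_num) (by norm_num), ENNReal.iInf_add, ENNReal.iInf_add]
  refine le_iInf fun f => ?_
  rw [ENNReal.add_iInf, ENNReal.iInf_add]
  refine le_iInf fun p => ?_
  have hreal : ∫ ω, loss x fstar (fhat ω) ∂μ ≤
      3 * loss x fstar f + 4 / n * ∫ ω, Z ω ∂μ + c / n := by
    refine (integral_mono_ae hI (hbint f) (hbound f f.2)).trans (le_of_eq ?_)
    have hsum : Integrable (fun ω => 3 * loss x fstar f + 4 / n * Z ω) μ :=
      (integrable_const _).add (hZint.const_mul _)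
    rw [integral_add hsum (integrable_const _),
      integral_add (integrable_const _) (hZint.const_mul _), integral_const,
      integral_const_mul]
    simp
  have hZ0 : 0 ≤ 4 / n * ∫ ω, Z ω ∂μ :=
    mul_nonneg (by positivity) (integral_nonneg fun ω => maxPartialSum_nonneg hne _)
  refine (ENNReal.ofReal_le_ofReal hreal).trans ?_
  rw [ENNReal.ofReal_add (add_nonneg (mul_nonneg (by norm_num) (hloss0 _ _)) hZ0) (by positivity),
    ENNReal.ofReal_add (mul_nonneg (by norm_num) (hloss0 _ _)) hZ0,
    ENNReal.ofReal_mul (by norm_num), ENNReal.ofReal_ofNat]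
  gcongr
  -- The bound by `n` is trivial, since `B` consists of indices in `Fin n`.
  have hvc : ∀ B, (positivityClass x ℱ).Shatters B → B.card ≤ min (Module.finrank ℝ ℱ + 1) n :=
    fun B hB => le_min ((card_le_of_shatters_positivityClass x ℱ B hB).trans (Nat.le_succ _))
      (by simpa using B.card_le_univ)
  have h := ofReal_integral_maxPartialSum_le hn hne (le_min (Nat.le_add_left 1 _) hn) hvc hm hind
    hint p.2.1 p.2.2
  simpa only [hmean] using h

end L1Regression

theorem mainTheorem11 :
    -- every element of a `d`-dimensional linear space is extremal with degree at most `d + 1`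
    (∀ (𝒳 : Type*) (ℱ : Submodule ℝ (𝒳 → ℝ)) (d : ℕ),
      1 ≤ d → Module.finrank ℝ ℱ = d →
        (∀ f ∈ ℱ, L1Regression.IsExtremal (ℱ : Set (𝒳 → ℝ)) f (d + 1)) ∧
        (∀ (n : ℕ) (x : Fin n → 𝒳),
          L1Regression.extremalSet x (ℱ : Set (𝒳 → ℝ)) (d + 1) = (ℱ : Set (𝒳 → ℝ)))) ∧
    -- the risk bound, with a numerical constant `κ`
    (∃ κ : ℝ, 0 < κ ∧
      ∀ (𝒳 : Type*) (Ω : Type*) [MeasurableSpace Ω] (μ : Measure Ω) [IsProbabilityMeasure μ]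
        (n : ℕ) (x : Fin n → 𝒳) (fstar : 𝒳 → ℝ) (Y : Fin n → Ω → ℝ)
        (ℱ : Submodule ℝ (𝒳 → ℝ)) (d : ℕ) (c : ℝ) (fhat : Ω → 𝒳 → ℝ),
        1 ≤ n →
        (∀ i, Measurable (Y i)) →
        iIndepFun Y μ →
        (∀ i, Integrable (Y i) μ) →
        (∀ i, ∫ ω, Y i ω ∂μ = fstar (x i)) →
        1 ≤ d → Module.finrank ℝ ℱ = d →
        0 ≤ c →
        (∀ᵐ ω ∂μ, fhat ω ∈
          L1Regression.estimatorSet x (fun i => Y i ω) (ℱ : Set (𝒳 → ℝ)) c) →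
        AEMeasurable (fun ω => L1Regression.loss x fstar (fhat ω)) μ →
          Integrable (fun ω => L1Regression.loss x fstar (fhat ω)) μ ∧
          ENNReal.ofReal (∫ ω, L1Regression.loss x fstar (fhat ω) ∂μ) ≤
            3 * L1Regression.lossToSet x fstar (ℱ : Set (𝒳 → ℝ))
              + ENNReal.ofReal κ *
                (⨅ p ∈ Set.Icc (1 : ℝ) 2,
                  L1Regression.noiseLevel μ Y p
                    * ENNReal.ofReal ((((min (d + 1) n : ℕ) : ℝ) / (n : ℝ)) ^ (1 - 1 / p)))
              + ENNReal.ofReal (c / n)) := by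
  refine ⟨fun 𝒳 ℱ d hd hfin => ?_, 228, by norm_num, ?_⟩
  -- `finrank` vanishes in infinite dimension, so `1 ≤ d` is what forces finite dimension.
  · have : FiniteDimensional ℝ ℱ := Module.finite_of_finrank_pos (by omega)
    exact ⟨fun f hf => L1Regression.isExtremal_of_finrank_le ℱ (Nat.le_add_left 1 d)
        (by omega) hf,
      fun n x => L1Regression.extremalSet_eq_of_finrank_le ℱ (Nat.le_add_left 1 d) (by omega) x⟩
  · intro 𝒳 Ω _ μ _ n x fstar Y ℱ d c fhat hn hm hind hint hmean hd hfin hc hfhat hloss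
    have : FiniteDimensional ℝ ℱ := Module.finite_of_finrank_pos (by omega)
    subst hfin
    exact L1Regression.integrable_loss_and_ofReal_integral_le hn x fstar ℱ hc hm hind hint hmean
      hfhat hloss
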